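/- A logic circuit is a finite acyclic directed graph whose nodes are inputs (no incoming edges), outputs (exactly one incoming edge, no outgoing edges), and gates. Each gate computes And, Or, Xor, Nand, Nor or Xnor of the values at the tails of its two incoming edges, or Not or the identity (a repeater) of the value at the tail of its single incoming edge. The size is the number of gates (including repeaters), the depth is the maximum number of gates on a directed path, and the fan-out of a node is the number of its outgoing edges (including edges to outputs). For propagate and generate bits $x_1,\dots,x_n$ and $y_1,\dots,y_n$, the carry bits are defined by $c_1=0$ and $c_{i+1}=y_i\vee(x_i\wedge c_i)$ for $1\le i\le n$. Theorem. For every $n\ge 1$ there is a logic circuit with inputs $x_1,\dots,x_n,y_1,\dots,y_n$ that computes all carry bits $c_2,\dots,c_{n+1}$ (for all values of the $2n$ input bits), in which every input and every gate has fan-out at most two, whose size is at most $13.5\,n$, and at most $9.5\,n$ if $n\ge 4096$, and whose depth is at most $$\log_2 n+8\left\lceil\sqrt{\log_2 n}\right\rceil+6\left\lceil\log_2\left\lceil\sqrt{\log_2 n}\right\rceil\right\rceil+2,$$ where for $n=1$ the undefined term $\lceil\log_2 0\rceil$ is read as $0$. -/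

import Mathlib

/-- The gate types of a logic circuit: And, Or, Xor, Not and their negations.
The negation of Not is the repeater, which computes the identity. -/
inductive GateKind : Type where
  | and | or | xor | nand | nor | xnor | not | repeater

namespace GateKind

/-- The number of incoming edges of a gate; it is at most two. -/
def arity : GateKind → ℕ
  | and => 2
  | or => 2
  | xor => 2
  | nand => 2
  | nor => 2
  | xnor => 2
  | not => 1
  | repeater => 1

/-- The Boolean function represented by a gate. -/
def eval : (k : GateKind) → (Fin k.arity → Bool) → Bool
  | and, v => v (0 : Fin 2) && v (1 : Fin 2)
  | or, v => v (0 : Fin 2) || v (1 : Fin 2)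
  | xor, v => Bool.xor (v (0 : Fin 2)) (v (1 : Fin 2))
  | nand, v => !(v (0 : Fin 2) && v (1 : Fin 2))
  | nor, v => !(v (0 : Fin 2) || v (1 : Fin 2))
  | xnor, v => !(Bool.xor (v (0 : Fin 2)) (v (1 : Fin 2)))
  | not, v => !(v (0 : Fin 1))
  | repeater, v => v (0 : Fin 1)

end GateKind

/-- A logic circuit with input nodes `I` and output nodes `O`: a finite acyclic directed graph.
Every gate `g` has `(kind g).arity` incoming edges, the `k`-th of which starts at `src g k`, which
is an input or a gate; every output node `o` has exactly one incoming edge, starting at `out o`. -/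
structure LogicCircuit (I O : Type) where
  Gate : Type
  fintypeGate : Fintype Gate
  kind : Gate → GateKind
  src : (g : Gate) → Fin (kind g).arity → I ⊕ Gate
  out : O → I ⊕ Gate
  /-- Since there are finitely many gates, this says that there is no directed cycle. -/
  acyclic : WellFounded fun h g : Gate => ∃ k, src g k = Sum.inr h

namespace LogicCircuit

variable {I O : Type}

attribute [instance] LogicCircuit.fintypeGate

/-- The value computed by a gate when the inputs carry the bits `x`. -/
def gateVal (C : LogicCircuit I O) (x : I → Bool) : C.Gate → Bool :=
  C.acyclic.fix fun g ih => (C.kind g).eval fun k =>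
    match h : C.src g k with
    | Sum.inl i => x i
    | Sum.inr g' => ih g' ⟨k, h⟩

/-- The value carried by a node (an input or a gate) when the inputs carry the bits `x`. -/
def nodeVal (C : LogicCircuit I O) (x : I → Bool) : I ⊕ C.Gate → Bool :=
  Sum.elim x (C.gateVal x)

theorem gateVal_eq (C : LogicCircuit I O) (x : I → Bool) (g : C.Gate) :
    C.gateVal x g = (C.kind g).eval fun k => C.nodeVal x (C.src g k) := by
  unfold gateVal
  rw [WellFounded.fix_eq]
  congr 1
  funext k
  split <;> rename_i h <;> exact (congrArg (C.nodeVal x) h).symm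

/-- The bit computed at an output node. -/
def outVal (C : LogicCircuit I O) (x : I → Bool) (o : O) : Bool :=
  C.nodeVal x (C.out o)

/-- The size: the number of gates, repeaters included. -/
def size (C : LogicCircuit I O) : ℕ := Fintype.card C.Gate

/-- The maximum number of gates on a directed path ending in the gate `g`. -/
def gateDepth (C : LogicCircuit I O) : C.Gate → ℕ :=
  C.acyclic.fix fun g ih => 1 + Finset.univ.sup fun k =>
    match h : C.src g k with
    | Sum.inl _ => 0
    | Sum.inr g' => ih g' ⟨k, h⟩

/-- The depth of a node; inputs have depth `0`. -/
def nodeDepth (C : LogicCircuit I O) : I ⊕ C.Gate → ℕ :=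
  Sum.elim (fun _ => 0) C.gateDepth

theorem gateDepth_eq (C : LogicCircuit I O) (g : C.Gate) :
    C.gateDepth g = 1 + Finset.univ.sup fun k => C.nodeDepth (C.src g k) := by
  unfold gateDepth
  rw [WellFounded.fix_eq]
  congr 2
  funext k
  split <;> rename_i h <;> exact (congrArg C.nodeDepth h).symm

/-- The depth: the maximum number of gates on a directed path. -/
def depth (C : LogicCircuit I O) : ℕ := Finset.univ.sup C.gateDepth

/-- The fan-out of a node (an input or a gate): the number of its outgoing edges, that is, of
edges into gates (counted with multiplicity) and of edges into output nodes. -/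
noncomputable def fanOut [Finite O] (C : LogicCircuit I O) (v : I ⊕ C.Gate) : ℕ :=
  Nat.card {e : (g : C.Gate) × Fin (C.kind g).arity // C.src e.1 e.2 = v} +
    Nat.card {o : O // C.out o = v}

end LogicCircuit

/-- The carry bits of `n` propagate/generate pairs: for `x = (x₁, …, xₙ)` and `y = (y₁, …, yₙ)`,
the entry with index `j` (`0 ≤ j ≤ n`) is `c_{j+1}`, where `c₁ = 0` and
`c_{i+1} = y_i ∨ (x_i ∧ c_i)`. -/
def carry {n : ℕ} (x y : Fin n → Bool) : Fin (n + 1) → Bool :=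
  Fin.induction false fun i c => y i || (x i && c)

/-- The circuit, whose inputs are `x₁, …, xₙ` (left summand) and `y₁, …, yₙ` (right summand),
computes all carry bits `c₂, …, c_{n+1}`. -/
def LogicCircuit.IsAdder {n : ℕ} (C : LogicCircuit (Fin n ⊕ Fin n) (Fin n)) : Prop :=
  ∀ (x y : Fin n → Bool) (i : Fin n), C.outVal (Sum.elim x y) i = carry x y i.succ

/-!
Circuits with fan-out two are described by a resource calculus. A token `(f, d)` is an unused
outgoing edge of a node that computes `f` in depth at most `d`. A gate consumes one token for each
of its incoming edges and provides two tokens of its value, so fan-out two is built in, and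
circuits are composed by adding multisets of tokens (`Derives`). The rules of the calculus are
sound by `realizable_addGate`, and `Realizable.exists_circuit` extracts a circuit from a multiset
of tokens. Tokens of constants are free, because gates with a constant input can be eliminated
or replaced by repeaters.

Two constructions are combined. The first is the recursion of Brent and Kung
(`CarryCircuit.double`): computing the carries of `n` positions is reduced to `n / 2` positions
at the cost of depth `4`, with at most `6 * n` gates in total over all steps.

The second one (`derives_levels`, `derives_level`) has depth `K + O(√K)` for `2 ^ K` positions, but
superlinear size. After each of about `√K` levels, the positions are divided into aligned blocks,
and *every position of a block holds its own copy* of the carry generated by the block and of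
the conjunction of its propagate bits. To pass from blocks of length `B` to blocks of length
`2 ^ k * B`, each copy of the generated carry is masked by the conjunction of the propagate bits of
the blocks behind it. After that only a disjunction of all blocks is needed, which a butterfly
network with fan-in and fan-out two computes in depth `k`, once for every position
(`derives_butterfly`). Since merging and copying happen in the same gates, and the masks are ready
in advance, the level increases the depth by just `k + 1`. The carries inside of a block take
longer (a Brent–Kung circuit of depth `4 * k` per level), but they do not feed the next level, so
this delay arises only once.

With `s = ⌈√(log₂ n)⌉ ≥ 5` and `q = 2 * ⌈log₂ s⌉ + 2`, `q` Brent–Kung steps followed by the second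
construction with `s` levels of block factor at most `2 ^ s` give depth
`⌊log₂ n⌋ + 3 * q + 6 * s + 6 ≤ log₂ n + 8 * s + 6 * ⌈log₂ s⌉ + 2`, and size at
most `9.5 * n` because `2 ^ q ≥ 4 * s ^ 2`. For `s ≤ 4`, the Brent–Kung recursion alone is good
enough, except for `n = 2 ^ 16`, where six of its steps are followed by four levels with block
factor at most `2 ^ 3`.
-/

/-! ### Adding gates and outputs to a circuit -/

namespace LogicCircuit

variable {I : Type}

/-- The circuit `C` with one more gate, of kind `k` and with incoming edges from the nodes `s`.
The old gates are `some g`, the new gate is `none`. -/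
def addGate (C : LogicCircuit I Empty) (k : GateKind) (s : Fin k.arity → I ⊕ C.Gate) :
    LogicCircuit I Empty where
  Gate := Option C.Gate
  fintypeGate := inferInstance
  kind := fun g => g.elim k C.kind
  src := fun g => match g with
    | none => fun i => Sum.map id some (s i)
    | some g => fun i => Sum.map id some (C.src g i)
  out := Empty.elim
  acyclic := by
    have key : ∀ (r : Option C.Gate → Option C.Gate → Prop),
        (∀ h g, r h (some g) → ∃ i g', C.src g i = Sum.inr g' ∧ h = some g') →
        (∀ h, r h none → ∃ g', h = some g') → WellFounded r := by
      intro r h1 h2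
      have hsome : ∀ g, Acc r (some g) := by
        intro g
        induction g using C.acyclic.induction with
        | _ g ih =>
          refine Acc.intro _ fun h hh => ?_
          obtain ⟨i, g', hi, rfl⟩ := h1 h g hh
          exact ih g' ⟨i, hi⟩
      refine ⟨fun g => ?_⟩
      cases g with
      | some g => exact hsome g
      | none =>
        refine Acc.intro _ fun h hh => ?_
        obtain ⟨g', rfl⟩ := h2 h hh
        exact hsome g'
    refine key _ ?_ ?_
    · rintro h g ⟨i, hi⟩
      rcases hs : C.src g i with a | g'
      · simp [hs] at hi
      · simp only [hs, Sum.map_inr, Sum.inr.injEq] at hi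
        exact ⟨i, g', hs, hi.symm⟩
    · rintro h ⟨i, hi⟩
      rcases hs : s i with a | g'
      · simp [hs] at hi
      · simp only [hs, Sum.map_inr, Sum.inr.injEq] at hi
        exact ⟨g', hi.symm⟩

variable (C : LogicCircuit I Empty) (k : GateKind) (s : Fin k.arity → I ⊕ C.Gate)

/-- The node of the extended circuit that corresponds to a node of `C`. -/
def oldNode (v : I ⊕ C.Gate) : I ⊕ (C.addGate k s).Gate := Sum.map id some v

/-- The node of the extended circuit that is the new gate. -/
def newNode : I ⊕ (C.addGate k s).Gate := Sum.inr (none : Option C.Gate)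

theorem oldNode_injective : Function.Injective (C.oldNode k s) :=
  Sum.map_injective.2 ⟨Function.injective_id, Option.some_injective _⟩

theorem oldNode_ne_newNode (v : I ⊕ C.Gate) : C.oldNode k s v ≠ C.newNode k s := by
  rcases v with a | a
  · exact Sum.inl_ne_inr
  · exact fun h => Option.some_ne_none a (Sum.inr_injective h)

theorem exists_oldNode_or_newNode (w : I ⊕ (C.addGate k s).Gate) :
    (∃ v, w = C.oldNode k s v) ∨ w = C.newNode k s := by
  rcases w with a | (_ | g)
  · exact Or.inl ⟨Sum.inl a, rfl⟩
  · exact Or.inr rfl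
  · exact Or.inl ⟨Sum.inr g, rfl⟩

theorem size_addGate : (C.addGate k s).size = C.size + 1 := by
  simp only [size]
  exact Fintype.card_option

theorem nodeVal_oldNode (x : I → Bool) (v : I ⊕ C.Gate) :
    (C.addGate k s).nodeVal x (C.oldNode k s v) = C.nodeVal x v := by
  rcases v with a | g
  · rfl
  · induction g using C.acyclic.induction with
    | _ g ih =>
      refine (gateVal_eq (C.addGate k s) x (some g : Option C.Gate)).trans
        (Eq.trans ?_ (gateVal_eq C x g).symm)
      refine congrArg (C.kind g).eval (funext fun i => ?_)
      change (C.addGate k s).nodeVal x (C.oldNode k s (C.src g i)) = _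
      rcases hs : C.src g i with a | g'
      · rfl
      · exact ih g' ⟨i, hs⟩

theorem nodeVal_newNode (x : I → Bool) :
    (C.addGate k s).nodeVal x (C.newNode k s) = k.eval fun i => C.nodeVal x (s i) :=
  (gateVal_eq (C.addGate k s) x (none : Option C.Gate)).trans
    (congrArg k.eval (funext fun i => C.nodeVal_oldNode k s x (s i)))

theorem nodeDepth_oldNode (v : I ⊕ C.Gate) :
    (C.addGate k s).nodeDepth (C.oldNode k s v) = C.nodeDepth v := by
  rcases v with a | g
  · rfl
  · induction g using C.acyclic.induction with
    | _ g ih =>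
      refine (gateDepth_eq (C.addGate k s) (some g : Option C.Gate)).trans
        (Eq.trans ?_ (gateDepth_eq C g).symm)
      refine congrArg (fun f : Fin (C.kind g).arity → ℕ => 1 + Finset.univ.sup f)
        (funext fun i => ?_)
      change (C.addGate k s).nodeDepth (C.oldNode k s (C.src g i)) = _
      rcases hs : C.src g i with a | g'
      · rfl
      · exact ih g' ⟨i, hs⟩

theorem nodeDepth_newNode :
    (C.addGate k s).nodeDepth (C.newNode k s) =
      1 + Finset.univ.sup fun i => C.nodeDepth (s i) :=
  (gateDepth_eq (C.addGate k s) (none : Option C.Gate)).trans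
    (congrArg (fun f : Fin k.arity → ℕ => 1 + Finset.univ.sup f)
      (funext fun i => C.nodeDepth_oldNode k s (s i)))

open Classical in
theorem fanOut_eq_sum {O : Type} [Fintype O] (C : LogicCircuit I O) (v : I ⊕ C.Gate) :
    C.fanOut v = (∑ g : C.Gate, ∑ i : Fin (C.kind g).arity, if C.src g i = v then 1 else 0) +
      ∑ o : O, if C.out o = v then 1 else 0 := by
  unfold fanOut
  congr 1
  · rw [Nat.card_eq_fintype_card, Fintype.card_subtype, Finset.card_filter, Fintype.sum_sigma]
  · rw [Nat.card_eq_fintype_card, Fintype.card_subtype, Finset.card_filter]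

open Classical in
theorem fanOut_addGate (w : I ⊕ (C.addGate k s).Gate) :
    (C.addGate k s).fanOut w = (∑ i, if C.oldNode k s (s i) = w then 1 else 0) +
      ∑ g : C.Gate, ∑ i : Fin (C.kind g).arity,
        if C.oldNode k s (C.src g i) = w then 1 else 0 := by
  refine (fanOut_eq_sum (C.addGate k s) w).trans ?_
  simp only [Finset.univ_eq_empty, Finset.sum_empty, add_zero]
  exact Fintype.sum_option _

open Classical in
theorem fanOut_oldNode (v : I ⊕ C.Gate) :
    (C.addGate k s).fanOut (C.oldNode k s v) =
      C.fanOut v + ∑ i, if s i = v then 1 else 0 := by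
  rw [fanOut_addGate, fanOut_eq_sum]
  simp only [Finset.univ_eq_empty, Finset.sum_empty, add_zero, (C.oldNode_injective k s).eq_iff]
  exact add_comm _ _

theorem fanOut_newNode : (C.addGate k s).fanOut (C.newNode k s) = 0 := by
  classical
  rw [fanOut_addGate]
  simp [oldNode_ne_newNode]

/-- The circuit without gates. -/
def noGates (I : Type) : LogicCircuit I Empty where
  Gate := Empty
  fintypeGate := inferInstance
  kind := Empty.elim
  src := fun g => g.elim
  out := Empty.elim
  acyclic := ⟨fun g => g.elim⟩

/-- The circuit `C` with output edges starting at the nodes `out`. -/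
def withOutputs {O : Type} (C : LogicCircuit I Empty) (out : O → I ⊕ C.Gate) :
    LogicCircuit I O where
  Gate := C.Gate
  fintypeGate := C.fintypeGate
  kind := C.kind
  src := C.src
  out := out
  acyclic := C.acyclic

variable {O : Type} (out : O → I ⊕ C.Gate)

theorem nodeVal_withOutputs (x : I → Bool) (v : I ⊕ C.Gate) :
    (C.withOutputs out).nodeVal x v = C.nodeVal x v := by
  rcases v with a | g
  · rfl
  · induction g using C.acyclic.induction with
    | _ g ih =>
      refine (gateVal_eq (C.withOutputs out) x g).trans (Eq.trans ?_ (gateVal_eq C x g).symm)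
      refine congrArg (C.kind g).eval (funext fun i => ?_)
      change (C.withOutputs out).nodeVal x (C.src g i) = _
      rcases hs : C.src g i with a | g'
      · rfl
      · exact ih g' ⟨i, hs⟩

theorem nodeDepth_withOutputs (v : I ⊕ C.Gate) :
    (C.withOutputs out).nodeDepth v = C.nodeDepth v := by
  rcases v with a | g
  · rfl
  · induction g using C.acyclic.induction with
    | _ g ih =>
      refine (gateDepth_eq (C.withOutputs out) g).trans (Eq.trans ?_ (gateDepth_eq C g).symm)
      refine congrArg (fun f : Fin (C.kind g).arity → ℕ => 1 + Finset.univ.sup f)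
        (funext fun i => ?_)
      change (C.withOutputs out).nodeDepth (C.src g i) = _
      rcases hs : C.src g i with a | g'
      · rfl
      · exact ih g' ⟨i, hs⟩

open Classical in
theorem fanOut_withOutputs [Fintype O] (v : I ⊕ C.Gate) :
    (C.withOutputs out).fanOut v = C.fanOut v + ∑ o, if out o = v then 1 else 0 := by
  rw [fanOut_eq_sum C]
  simp only [Finset.univ_eq_empty, Finset.sum_empty, add_zero]
  exact fanOut_eq_sum (C.withOutputs out) v

end LogicCircuit

/-! ### Tokens and their soundness -/

/-- A token `(f, d)` stands for one unused outgoing edge of a node that computes the Boolean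
function `f` of the inputs and has depth at most `d`. -/
abbrev Token (I : Type) : Type := ((I → Bool) → Bool) × ℕ

/-- The multiset consisting of the single token `(f, d)`. -/
def tok {I : Type} (f : (I → Bool) → Bool) (d : ℕ) : Multiset (Token I) := {(f, d)}

/-- The function of the token is not constant, and the depth bound of the token is at most `D`. -/
def Token.Essential {I : Type} (D : ℕ) (a : Token I) : Prop := (a.1 ≠ ⊥ ∧ a.1 ≠ ⊤) ∧ a.2 ≤ D

open Classical in
/-- The tokens `A` are available in some circuit of depth at most `D` with at most `m` gates: `P`
assigns to each token of `A` a node of the circuit, such that each node has at most two outgoing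
edges, counting the edges in the circuit and the tokens assigned to the node. Tokens of constant
functions and tokens with a depth bound greater than `D` are exempted, and not assigned to a
node: the former can be eliminated from any circuit, the latter cannot contribute to an output. -/
def Realizable {I : Type} (D : ℕ) (A : Multiset (Token I)) (m : ℕ) : Prop :=
  ∃ (C : LogicCircuit I Empty) (P : Multiset (Token I × (I ⊕ C.Gate))),
    (C.size ≤ m ∧ ∀ v, C.nodeDepth v ≤ D) ∧ P.map Prod.fst = A.filter (Token.Essential D) ∧
    (∀ p ∈ P, (fun x => C.nodeVal x p.2) = p.1.1 ∧ C.nodeDepth p.2 ≤ p.1.2) ∧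
    ∀ v, C.fanOut v + (P.map Prod.snd).count v ≤ 2

/-- `Derives A c B`: at the cost of at most `c` additional gates, the tokens `A` can be exchanged
for the tokens `B` in every circuit, whatever other tokens are available in it, and whatever
bound is imposed on the depth. -/
def Derives {I : Type} (A : Multiset (Token I)) (c : ℕ) (B : Multiset (Token I)) : Prop :=
  ∀ D R m, Realizable D (A + R) m → Realizable D (B + R) (m + c)

section Realizable

variable {I : Type} {D : ℕ}

/-- If the first components of the pairs `P` comprise a family `t`, then so do the first components
of a family of pairs from `P`. -/
theorem exists_assignment {ι α β : Type*} [Nonempty β] (S : Finset ι) (t : ι → α) (Q : Multiset α)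
    (P : Multiset (α × β)) (h : P.map Prod.fst = S.val.map t + Q) :
    ∃ (s : ι → β) (P' : Multiset (α × β)), P'.map Prod.fst = Q ∧
      P = S.val.map (fun i => (t i, s i)) + P' := by
  classical
  induction S using Finset.induction_on generalizing P with
  | empty => exact ⟨fun _ => Classical.arbitrary β, P, by simpa using h, by simp⟩
  | insert a S ha ih =>
    rw [Finset.insert_val_of_notMem ha, Multiset.map_cons, Multiset.cons_add] at h
    obtain ⟨p, hp, hpa⟩ := Multiset.mem_map.1 (h ▸ Multiset.mem_cons_self (t a) _)
    obtain ⟨P, rfl⟩ := Multiset.exists_cons_of_mem hp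
    rw [Multiset.map_cons, hpa, Multiset.cons_inj_right] at h
    obtain ⟨s, P', hP', rfl⟩ := ih P h
    refine ⟨Function.update s a p.2, P', hP', ?_⟩
    rw [Finset.insert_val_of_notMem ha, Multiset.map_cons, Multiset.cons_add, Function.update_self,
      ← hpa]
    congr 2
    refine Multiset.map_congr rfl fun i hi => ?_
    rw [Function.update_of_ne]
    rintro rfl
    exact ha hi

/-- A new gate uses up one token for each of its incoming edges, and provides two new tokens. -/
theorem realizable_addGate (k : GateKind) (t : Fin k.arity → Token I) (f : (I → Bool) → Bool)
    (d : ℕ) (hf : ∀ x, f x = k.eval fun i => (t i).1 x) (hd : ∀ i, (t i).2 + 1 ≤ d)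
    (hk : 0 < k.arity) (ht : ∀ i, (t i).Essential D)
    (hf0 : Token.Essential D (f, d)) {R : Multiset (Token I)} {m : ℕ}
    (h : Realizable D (Finset.univ.val.map t + R) m) :
    Realizable D (tok f d + tok f d + R) (m + 1) := by
  classical
  obtain ⟨C, P, hsize, hP, hval, hfan⟩ := h
  rw [Multiset.filter_add, Multiset.filter_eq_self.2 (by simpa using ht)] at hP
  obtain ⟨p, -, -⟩ : ∃ p ∈ P, p.1 = t ⟨0, hk⟩ := Multiset.mem_map.1
    (hP ▸ Multiset.mem_add.2 (Or.inl (Multiset.mem_map.2 ⟨⟨0, hk⟩, by simp, rfl⟩)))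
  have : Nonempty (I ⊕ C.Gate) := ⟨p.2⟩
  obtain ⟨s, P', hP', rfl⟩ := exists_assignment _ t _ _ hP
  have hs : ∀ i, (fun x => C.nodeVal x (s i)) = (t i).1 ∧ C.nodeDepth (s i) ≤ (t i).2 :=
    fun i => hval (t i, s i) (Multiset.mem_add.2 (Or.inl (Multiset.mem_map.2 ⟨i, by simp, rfl⟩)))
  have hnew : (C.addGate k s).nodeDepth (C.newNode k s) ≤ d := by
    rw [C.nodeDepth_newNode]
    have h0 := hd ⟨0, hk⟩
    have : (Finset.univ.sup fun i => C.nodeDepth (s i)) ≤ d - 1 :=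
      Finset.sup_le fun i _ => (hs i).2.trans (by have := hd i; omega)
    omega
  refine ⟨C.addGate k s, ((f, d), C.newNode k s) ::ₘ ((f, d), C.newNode k s) ::ₘ
    P'.map (fun p => (p.1, C.oldNode k s p.2)), ?_, ?_, ?_, ?_⟩
  · refine ⟨by rw [C.size_addGate]; have := hsize.1; omega, fun w => ?_⟩
    rcases C.exists_oldNode_or_newNode k s w with ⟨v, rfl⟩ | rfl
    · exact (C.nodeDepth_oldNode k s v).trans_le (hsize.2 v)
    · exact hnew.trans hf0.2
  · simp [tok, hf0, ← hP', Multiset.map_map]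
  · intro p hp
    rw [Multiset.mem_cons, Multiset.mem_cons, ← or_assoc, or_self] at hp
    rcases hp with rfl | hp
    · constructor
      · funext x
        rw [C.nodeVal_newNode]
        exact (congrArg k.eval (funext fun i => congrFun (hs i).1 x)).trans (hf x).symm
      · exact hnew
    · obtain ⟨p, hp', rfl⟩ := Multiset.mem_map.1 hp
      obtain ⟨h1, h2⟩ := hval p (Multiset.mem_add.2 (Or.inr hp'))
      exact ⟨(funext fun x => C.nodeVal_oldNode k s x p.2).trans h1,
        (C.nodeDepth_oldNode k s p.2).trans_le h2⟩
  · intro w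
    simp only [Multiset.map_cons, Multiset.count_cons, Multiset.map_map]
    have hcomp : (Prod.snd ∘ fun p : Token I × (I ⊕ C.Gate) => (p.1, C.oldNode k s p.2)) =
      C.oldNode k s ∘ Prod.snd := rfl
    rw [hcomp, ← Multiset.map_map]
    rcases C.exists_oldNode_or_newNode k s w with ⟨v, rfl⟩ | rfl
    · rw [if_neg (C.oldNode_ne_newNode k s v), C.fanOut_oldNode,
        Multiset.count_map_eq_count' _ _ (C.oldNode_injective k s)]
      have := hfan v
      rw [Multiset.map_add, Multiset.count_add, Multiset.map_map, Multiset.count_map] at this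
      rw [← Finset.card_filter]
      have h3 : (Multiset.filter (fun a => v = (Prod.snd ∘ fun i => (t i, s i)) a)
          Finset.univ.val).card = (Finset.univ.filter fun i => s i = v).card := by
        simp [Finset.card_def, eq_comm]
      omega
    · have : Multiset.count (C.newNode k s) ((P'.map Prod.snd).map (C.oldNode k s)) = 0 := by
        rw [Multiset.count_eq_zero]
        intro h
        obtain ⟨a, -, ha⟩ := Multiset.mem_map.1 h
        exact C.oldNode_ne_newNode k s a ha
      rw [C.fanOut_newNode, this, if_pos rfl]

theorem Realizable.of_add {A B : Multiset (Token I)} {m : ℕ} (h : Realizable D (A + B) m) :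
    Realizable D B m := by
  classical
  induction A using Multiset.induction_on with
  | empty => simpa using h
  | cons a A ih =>
    refine ih ?_
    obtain ⟨C, P, hsize, hP, hval, hfan⟩ := h
    rw [Multiset.cons_add] at hP
    by_cases ha : a.Essential D
    · rw [Multiset.filter_cons_of_pos _ ha] at hP
      obtain ⟨p, hp, hpf⟩ := Multiset.mem_map.1 (hP ▸ Multiset.mem_cons_self a _)
      obtain ⟨P, rfl⟩ := Multiset.exists_cons_of_mem hp
      rw [Multiset.map_cons, hpf, Multiset.cons_inj_right] at hP
      refine ⟨C, P, hsize, hP, fun q hq => hval q (Multiset.mem_cons_of_mem hq), fun v => ?_⟩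
      have := hfan v
      rw [Multiset.map_cons, Multiset.count_cons] at this
      omega
    · rw [Multiset.filter_cons_of_neg _ ha] at hP
      exact ⟨C, P, hsize, hP, hval, hfan⟩

theorem Realizable.mono {A : Multiset (Token I)} {m m' : ℕ} (h : Realizable D A m)
    (hm : m ≤ m') : Realizable D A m' := by
  obtain ⟨C, P, hsize, h⟩ := h
  exact ⟨C, P, ⟨hsize.1.trans hm, hsize.2⟩, h⟩

/-- Tokens that are not essential are available for free. -/
theorem Realizable.add_tok {f : (I → Bool) → Bool} {d : ℕ} (hf : ¬Token.Essential D (f, d))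
    {A : Multiset (Token I)} {m : ℕ} (h : Realizable D A m) : Realizable D (tok f d + A) m := by
  classical
  obtain ⟨C, P, hsize, hP, h⟩ := h
  refine ⟨C, P, hsize, ?_, h⟩
  rw [tok, Multiset.singleton_add, Multiset.filter_cons_of_neg _ hf, hP]

/-- The depth bounds of tokens can be increased. -/
theorem Realizable.weaken {f : (I → Bool) → Bool} {d d' : ℕ} {A : Multiset (Token I)} {m : ℕ}
    (h : Realizable D (tok f d + A) m) (hd : d ≤ d') : Realizable D (tok f d' + A) m := by
  classical
  by_cases hf' : Token.Essential D (f, d')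
  · have hf : Token.Essential D (f, d) := ⟨hf'.1, hd.trans hf'.2⟩
    obtain ⟨C, P, hsize, hP, hval, hfan⟩ := h
    simp only [tok, Multiset.singleton_add] at hP ⊢
    rw [Multiset.filter_cons_of_pos _ hf] at hP
    obtain ⟨p, hp, hpf⟩ := Multiset.mem_map.1 (hP ▸ Multiset.mem_cons_self (f, d) _)
    obtain ⟨P, rfl⟩ := Multiset.exists_cons_of_mem hp
    rw [Multiset.map_cons, hpf, Multiset.cons_inj_right] at hP
    refine ⟨C, ((f, d'), p.2) ::ₘ P, hsize, ?_, ?_, ?_⟩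
    · rw [Multiset.filter_cons_of_pos _ hf', Multiset.map_cons, hP]
    · intro q hq
      rcases Multiset.mem_cons.1 hq with rfl | hq
      · have := hval p (Multiset.mem_cons_self _ _)
        rw [hpf] at this
        exact ⟨this.1, this.2.trans hd⟩
      · exact hval q (Multiset.mem_cons_of_mem hq)
    · intro v
      have := hfan v
      rwa [Multiset.map_cons] at this ⊢
  · exact h.of_add.add_tok hf'

theorem sum_tok {ι : Type*} (s : Finset ι) (f : ι → (I → Bool) → Bool) (d : ℕ) :
    ∑ i ∈ s, tok (f i) d = s.val.map fun i => (f i, d) := by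
  classical
  induction s using Finset.induction_on with
  | empty => rfl
  | insert a s ha ih =>
    rw [Finset.sum_insert ha, ih, Finset.insert_val_of_notMem ha, Multiset.map_cons, tok,
      Multiset.singleton_add]

/-- In the circuit without gates, two tokens are available for each input. -/
theorem realizable_inputs [Fintype I] :
    Realizable D (∑ i : I, 2 • tok (fun x : I → Bool => x i) 0) 0 := by
  classical
  set t : I → Token I := fun i => (fun x => x i, 0) with ht
  have hconst : ∀ i : I, (t i).Essential D := by
    refine fun i => ⟨⟨fun h => ?_, fun h => ?_⟩, Nat.zero_le D⟩
    · simpa [t] using congrFun h (fun _ => true)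
    · simpa [t] using congrFun h (fun _ => false)
  set node : I → I ⊕ (LogicCircuit.noGates I).Gate := Sum.inl with hnode
  have hmem : ∀ a ∈ Finset.univ.val.map t + Finset.univ.val.map t, a.Essential D := by
    simpa using hconst
  rw [Finset.sum_nsmul, sum_tok, two_nsmul]
  refine ⟨LogicCircuit.noGates I, Finset.univ.val.map (fun i => (t i, node i)) +
    Finset.univ.val.map (fun i => (t i, node i)), ?_, ?_, ?_, ?_⟩
  · refine ⟨(Fintype.card_empty).le, fun v => ?_⟩
    rcases v with i | g
    · exact Nat.zero_le D
    · exact Empty.elim g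
  · rw [Multiset.filter_eq_self.2 hmem, Multiset.map_add, Multiset.map_map]
    rfl
  · intro p hp
    rw [Multiset.mem_add, or_self] at hp
    obtain ⟨i, -, rfl⟩ := Multiset.mem_map.1 hp
    exact ⟨rfl, le_rfl⟩
  · intro v
    have h0 : (LogicCircuit.noGates I).fanOut v = 0 := by
      have : IsEmpty (LogicCircuit.noGates I).Gate := inferInstanceAs (IsEmpty Empty)
      simp [LogicCircuit.fanOut_eq_sum]
    have hnd : (Multiset.map node Finset.univ.val).Nodup :=
      Finset.univ.nodup.map Sum.inl_injective
    have h1 := Multiset.nodup_iff_count_le_one.1 hnd v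
    rw [h0, zero_add, Multiset.map_add, Multiset.count_add, Multiset.map_map]
    exact add_le_add h1 h1

/-- A circuit in which a token of `f o` is available for each `o` can be given outputs that
compute the functions `f o`. -/
theorem Realizable.exists_circuit {O : Type} [Fintype O] [Nonempty O]
    {f : O → (I → Bool) → Bool} {m : ℕ} (hf : ∀ o, f o ≠ ⊥ ∧ f o ≠ ⊤)
    (h : Realizable D (∑ o, tok (f o) D) m) :
    ∃ C : LogicCircuit I O, (∀ x o, C.outVal x o = f o x) ∧ (∀ v, C.fanOut v ≤ 2) ∧
      C.size ≤ m ∧ C.depth ≤ D := by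
  classical
  obtain ⟨C, P, hsize, hP, hval, hfan⟩ := h
  have hmem : ∀ a ∈ Finset.univ.val.map (fun o => (f o, D)), Token.Essential D a := by
    intro a ha
    obtain ⟨o, -, rfl⟩ := Multiset.mem_map.1 ha
    exact ⟨hf o, le_rfl⟩
  rw [sum_tok, Multiset.filter_eq_self.2 hmem] at hP
  obtain ⟨p, -, -⟩ : ∃ p ∈ P, p.1 = (f (Classical.arbitrary O), D) := Multiset.mem_map.1
    (hP ▸ Multiset.mem_map.2 ⟨_, by simp, rfl⟩)
  have : Nonempty (I ⊕ C.Gate) := ⟨p.2⟩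
  obtain ⟨out, P', hP', rfl⟩ := exists_assignment Finset.univ (fun o => (f o, D)) 0 P
    (by rw [hP, add_zero])
  have hout : ∀ o, (fun x => C.nodeVal x (out o)) = f o ∧ C.nodeDepth (out o) ≤ D := fun o =>
    hval ((f o, D), out o)
      (Multiset.mem_add.2 (Or.inl (Multiset.mem_map.2 ⟨o, by simp, rfl⟩)))
  have hfan' : ∀ v, (C.withOutputs out).fanOut v ≤ 2 := by
    intro (v : I ⊕ C.Gate)
    have h1 := hfan v
    rw [Multiset.map_add, Multiset.count_add, Multiset.map_map, Multiset.count_map] at h1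
    have h2 : (Multiset.filter (fun o => v = (Prod.snd ∘ fun o => ((f o, D), out o)) o)
        Finset.univ.val).card = (Finset.univ.filter fun o => out o = v).card := by
      simp [Finset.card_def, eq_comm]
    refine (C.fanOut_withOutputs out v).trans_le ?_
    rw [← Finset.card_filter]
    omega
  exact ⟨C.withOutputs out,
    fun x o => (C.nodeVal_withOutputs out x (out o)).trans (congrFun (hout o).1 x), hfan', hsize.1,
    Finset.sup_le fun g _ => (C.nodeDepth_withOutputs out (Sum.inr g)).trans_le (hsize.2 _)⟩

end Realizable

/-! ### The rules of the token calculus -/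

namespace Derives

variable {I : Type} {A A' B B' C : Multiset (Token I)} {a b c d e : ℕ} {f g : (I → Bool) → Bool}

theorem trans (h : Derives A a B) (h' : Derives B b C) : Derives A (a + b) C := by
  intro D R m hR
  rw [← add_assoc]
  exact h' D R _ (h D R m hR)

theorem mono (h : Derives A a B) (hab : a ≤ b) : Derives A b B :=
  fun D R m hR => (h D R m hR).mono (by omega)

theorem refl (A : Multiset (Token I)) : Derives A 0 A := fun _ _ _ hR => hR

theorem add (h : Derives A a B) (h' : Derives A' b B') : Derives (A + A') (a + b) (B + B') := by
  intro D R m hR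
  rw [add_assoc] at hR
  have h1 := h D _ m hR
  rw [add_left_comm] at h1
  have h2 := h' D _ _ h1
  rwa [add_left_comm, ← add_assoc, add_assoc m] at h2

/-- Tokens can be discarded. -/
theorem of_le (h : B ≤ A) : Derives A 0 B := by
  obtain ⟨C, rfl⟩ := Multiset.le_iff_exists_add.1 h
  intro D R m hR
  rw [add_comm B C, add_assoc] at hR
  exact hR.of_add

theorem sum {ι : Type*} (s : Finset ι) {A B : ι → Multiset (Token I)} {a : ι → ℕ}
    (h : ∀ i ∈ s, Derives (A i) (a i) (B i)) :
    Derives (∑ i ∈ s, A i) (∑ i ∈ s, a i) (∑ i ∈ s, B i) := by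
  classical
  induction s using Finset.induction_on with
  | empty => simpa using refl 0
  | insert i s hi ih =>
    rw [Finset.sum_insert hi, Finset.sum_insert hi, Finset.sum_insert hi]
    exact (h i (Finset.mem_insert_self i s)).add
      (ih fun j hj => h j (Finset.mem_insert_of_mem hj))

theorem nsmul (n : ℕ) (h : Derives A a B) : Derives (n • A) (n * a) (n • B) := by
  have := sum (Finset.range n) (A := fun _ => A) (B := fun _ => B) (a := fun _ => a) fun _ _ => h
  simpa using this

theorem tok_mono (hd : d ≤ e) : Derives (tok f d) 0 (tok f e) :=
  fun _ _ _ hR => hR.weaken hd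

theorem tok_bot : Derives 0 0 (tok (⊥ : (I → Bool) → Bool) d) := by
  intro D R m hR
  rw [zero_add] at hR
  exact hR.add_tok fun h => h.1.1 rfl

theorem tok_top : Derives 0 0 (tok (⊤ : (I → Bool) → Bool) d) := by
  intro D R m hR
  rw [zero_add] at hR
  exact hR.add_tok fun h => h.1.2 rfl

/-- A repeater doubles a token. -/
theorem rep : Derives (tok f d) 1 (2 • tok f (d + 1)) := by
  intro D R m hR
  by_cases hf : ¬Token.Essential D (f, d + 1)
  · rw [two_nsmul, add_assoc]
    exact ((hR.of_add.add_tok hf).add_tok hf).mono (Nat.le_succ m)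
  · rw [two_nsmul]
    exact realizable_addGate .repeater (fun _ : Fin 1 => (f, d)) f (d + 1) (fun _ => rfl)
      (fun _ => le_rfl) Nat.one_pos
      (fun _ => ⟨(not_not.1 hf).1, (Nat.le_succ d).trans (not_not.1 hf).2⟩)
      (not_not.1 hf) hR

/-- An And gate. If the conjunction is constant, no gate is needed; if one of the operands is
constantly true, a repeater of the other one takes the place of the gate. -/
theorem and (hd : d ≤ c) (he : e ≤ c) :
    Derives (tok f d + tok g e) 1 (2 • tok (f ⊓ g) (c + 1)) := by
  intro D R m hR
  by_cases h : ¬Token.Essential D (f ⊓ g, c + 1)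
  · rw [two_nsmul, add_assoc]
    exact ((hR.of_add.add_tok h).add_tok h).mono (Nat.le_succ m)
  by_cases hf : f = ⊤
  · rw [add_assoc] at hR
    subst hf
    rw [top_inf_eq]
    exact rep D R m (hR.of_add.weaken he)
  by_cases hg : g = ⊤
  · rw [add_comm (tok f d), add_assoc] at hR
    subst hg
    rw [inf_top_eq]
    exact rep D R m (hR.of_add.weaken hd)
  have hc : c ≤ D := (Nat.le_succ c).trans (not_not.1 h).2
  have hf' : f ≠ ⊥ := by rintro rfl; simp [Token.Essential] at h
  have hg' : g ≠ ⊥ := by rintro rfl; simp [Token.Essential] at h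
  rw [two_nsmul]
  exact realizable_addGate .and (![(f, d), (g, e)] : Fin 2 → Token I) (f ⊓ g) (c + 1)
    (fun _ => rfl) (fun i : Fin 2 => by fin_cases i <;> simpa) Nat.two_pos
    (fun i : Fin 2 => by fin_cases i; exacts [⟨⟨hf', hf⟩, hd.trans hc⟩, ⟨⟨hg', hg⟩, he.trans hc⟩])
    (not_not.1 h) hR

/-- An Or gate. If the disjunction is constant, no gate is needed; if one of the operands is
constantly false, a repeater of the other one takes the place of the gate. -/
theorem or (hd : d ≤ c) (he : e ≤ c) :
    Derives (tok f d + tok g e) 1 (2 • tok (f ⊔ g) (c + 1)) := by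
  intro D R m hR
  by_cases h : ¬Token.Essential D (f ⊔ g, c + 1)
  · rw [two_nsmul, add_assoc]
    exact ((hR.of_add.add_tok h).add_tok h).mono (Nat.le_succ m)
  by_cases hf : f = ⊥
  · rw [add_assoc] at hR
    subst hf
    rw [bot_sup_eq]
    exact rep D R m (hR.of_add.weaken he)
  by_cases hg : g = ⊥
  · rw [add_comm (tok f d), add_assoc] at hR
    subst hg
    rw [sup_bot_eq]
    exact rep D R m (hR.of_add.weaken hd)
  have hc : c ≤ D := (Nat.le_succ c).trans (not_not.1 h).2
  have hf' : f ≠ ⊤ := by rintro rfl; simp [Token.Essential] at h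
  have hg' : g ≠ ⊤ := by rintro rfl; simp [Token.Essential] at h
  rw [two_nsmul]
  exact realizable_addGate .or (![(f, d), (g, e)] : Fin 2 → Token I) (f ⊔ g) (c + 1)
    (fun _ => rfl) (fun i : Fin 2 => by fin_cases i <;> simpa) Nat.two_pos
    (fun i : Fin 2 => by fin_cases i; exacts [⟨⟨hf, hf'⟩, hd.trans hc⟩, ⟨⟨hg, hg'⟩, he.trans hc⟩])
    (not_not.1 h) hR

end Derives

/-! ### Carries of sequences -/

section Carries

variable {α : Type*} [DistribLattice α] [BoundedOrder α]

/-- The carry before position `i` for the propagate bits `x` and the generate bits `y`, where the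
carry before position `0` is `⊥`. -/
def seqCarry (x y : ℕ → α) : ℕ → α
  | 0 => ⊥
  | i + 1 => y i ⊔ (x i ⊓ seqCarry x y i)

/-- The conjunction of the propagate bits at the positions before `i`. -/
def propagate (x : ℕ → α) : ℕ → α
  | 0 => ⊤
  | i + 1 => propagate x i ⊓ x i

theorem propagate_one (x : ℕ → α) : propagate x 1 = x 0 := by simp [propagate]

theorem seqCarry_one (x y : ℕ → α) : seqCarry x y 1 = y 0 := by simp [seqCarry]

theorem propagate_add (x : ℕ → α) (a b : ℕ) :
    propagate x (a + b) = propagate x a ⊓ propagate (fun i => x (a + i)) b := by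
  induction b with
  | zero => simp [propagate]
  | succ b ih => rw [← add_assoc, propagate, ih, propagate, inf_assoc]

/-- The carry after two consecutive intervals is generated in the second one, or generated in the
first one and propagated through the second one. -/
theorem seqCarry_add (x y : ℕ → α) (a b : ℕ) :
    seqCarry x y (a + b) = seqCarry (fun i => x (a + i)) (fun i => y (a + i)) b ⊔
      (seqCarry x y a ⊓ propagate (fun i => x (a + i)) b) := by
  induction b with
  | zero => simp [propagate, seqCarry]
  | succ b ih =>
    rw [← add_assoc, seqCarry, ih, seqCarry, propagate, inf_sup_left, sup_assoc]
    congr 2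
    rw [inf_left_comm, inf_comm (x (a + b))]

theorem propagate_block (x : ℕ → α) (B u : ℕ) :
    propagate (fun v => propagate (fun i => x (v * B + i)) B) u = propagate x (u * B) := by
  induction u with
  | zero => simp [propagate]
  | succ u ih => rw [propagate, ih, Nat.succ_mul, propagate_add]

/-- Blocks of length `B` behave like single positions: their propagate bits are the conjunctions of
the propagate bits in the block, their generate bits are the carries generated by the block. -/
theorem seqCarry_block (x y : ℕ → α) (B u : ℕ) :
    seqCarry (fun v => propagate (fun i => x (v * B + i)) B)
      (fun v => seqCarry (fun i => x (v * B + i)) (fun i => y (v * B + i)) B) u =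
      seqCarry x y (u * B) := by
  induction u with
  | zero => simp [seqCarry]
  | succ u ih => rw [seqCarry, ih, Nat.succ_mul, seqCarry_add, inf_comm]

theorem propagate_pair (x : ℕ → α) (u : ℕ) :
    propagate (fun i => x (2 * i) ⊓ x (2 * i + 1)) u = propagate x (2 * u) := by
  induction u with
  | zero => simp [propagate]
  | succ u ih => rw [propagate, ih, Nat.mul_succ, propagate, propagate, inf_assoc]

theorem seqCarry_pair (x y : ℕ → α) (u : ℕ) :
    seqCarry (fun i => x (2 * i + 1) ⊓ x (2 * i))
      (fun i => y (2 * i + 1) ⊔ (x (2 * i + 1) ⊓ y (2 * i))) u = seqCarry x y (2 * u) := by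
  induction u with
  | zero => simp [seqCarry]
  | succ u ih => rw [seqCarry, ih, Nat.mul_succ, seqCarry, seqCarry, inf_sup_left, inf_assoc,
      sup_assoc]

/-- A carry is the disjunction of all generate bits, each masked by the conjunction of the
propagate bits behind it; the latter is a prefix conjunction of the reversed sequence. -/
theorem seqCarry_eq_sup (x y : ℕ → α) (n : ℕ) :
    (Finset.range n).sup (fun u => y u ⊓ propagate (fun i => x (n - 1 - i)) (n - 1 - u)) =
      seqCarry x y n := by
  induction n with
  | zero => simp [seqCarry]
  | succ n ih =>
    rw [Finset.range_add_one, Finset.sup_insert, seqCarry, ← ih, Finset.sup_inf_distrib_left]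
    congr 1
    · simp [propagate]
    · refine Finset.sup_congr rfl fun u hu => ?_
      have hu := Finset.mem_range.1 hu
      have h1 : n + 1 - 1 - u = 1 + (n - 1 - u) := by omega
      have h2 : (fun i => x (n + 1 - 1 - (1 + i))) = fun i => x (n - 1 - i) := by
        funext i
        congr 1
        omega
      rw [h1, propagate_add, propagate_one, h2, inf_left_comm]
      rfl

theorem sup_range_add (f : ℕ → α) (a b : ℕ) :
    (Finset.range (a + b)).sup f =
      (Finset.range a).sup f ⊔ (Finset.range b).sup fun i => f (a + i) := by
  induction b with
  | zero => simp
  | succ b ih =>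
    rw [← add_assoc, Finset.range_add_one, Finset.sup_insert, ih, Finset.range_add_one,
      Finset.sup_insert, sup_left_comm]

end Carries

theorem sum_range_two_mul {M : Type*} [AddCommMonoid M] (f : ℕ → M) (m : ℕ) :
    ∑ i ∈ Finset.range (2 * m), f i = ∑ i ∈ Finset.range m, (f (2 * i) + f (2 * i + 1)) := by
  induction m with
  | zero => simp
  | succ m ih =>
    rw [Nat.mul_succ, Finset.sum_range_succ, Finset.sum_range_succ, ih, Finset.sum_range_succ,
      add_assoc]

theorem sum_range_mul {M : Type*} [AddCommMonoid M] (f : ℕ → M) (a b : ℕ) :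
    ∑ i ∈ Finset.range (a * b), f i =
      ∑ u ∈ Finset.range a, ∑ p ∈ Finset.range b, f (u * b + p) := by
  induction a with
  | zero => simp
  | succ a ih => rw [Nat.succ_mul, Finset.sum_range_add, ih, Finset.sum_range_succ]

/-! ### The Brent–Kung recursion -/

section Circuits

open Finset

variable {I : Type}

theorem Derives.congr {A A' B B' : Multiset (Token I)} {a b : ℕ} (h : Derives A a B)
    (hA : A' = A) (hB : B' = B) (hab : a ≤ b) : Derives A' b B' := by
  subst hA hB
  exact h.mono hab

theorem Derives.two_tok_mono {f : (I → Bool) → Bool} {d e : ℕ} (h : d ≤ e) :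
    Derives (2 • tok f d) 0 (2 • tok f e) :=
  Derives.nsmul 2 (Derives.tok_mono h)

theorem Derives.sum_range {n c a : ℕ} {A B : ℕ → Multiset (Token I)}
    (h : ∀ i < n, Derives (A i) c (B i)) (ha : n * c ≤ a) :
    Derives (∑ i ∈ range n, A i) a (∑ i ∈ range n, B i) :=
  (Derives.sum (range n) (a := fun _ => c) fun i hi => h i (mem_range.1 hi)).mono (by simpa)

/-- There are circuits with fan-out two, with `S` gates and of depth `D`, that compute the first
`n` carries of arbitrary propagate and generate bits. -/
def CarryCircuit (I : Type) (n S D : ℕ) : Prop :=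
  ∀ (x y : ℕ → (I → Bool) → Bool) (d : ℕ),
    Derives (∑ i ∈ range n, (2 • tok (x i) d + 2 • tok (y i) d)) S
      (∑ i ∈ range n, 2 • tok (seqCarry x y (i + 1)) (d + D))

/-- Two adjacent positions are combined to one. Tokens of the first position are kept: they serve
to compute the carry between the two positions. -/
theorem derives_pair (x₀ x₁ y₀ y₁ : (I → Bool) → Bool) (d : ℕ) :
    Derives ((2 • tok x₀ d + 2 • tok y₀ d) + (2 • tok x₁ d + 2 • tok y₁ d)) 3
      ((2 • tok (x₁ ⊓ x₀) (d + 2) + 2 • tok (y₁ ⊔ (x₁ ⊓ y₀)) (d + 2)) +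
        (tok x₀ d + tok y₀ d)) := by
  have h1 : Derives (tok x₁ d + tok x₀ d) 1 (2 • tok (x₁ ⊓ x₀) (d + 2)) :=
    (Derives.and le_rfl le_rfl).trans (Derives.two_tok_mono (Nat.le_succ _))
  have h2 : Derives (tok y₁ d + (tok x₁ d + tok y₀ d)) 2 (2 • tok (y₁ ⊔ (x₁ ⊓ y₀)) (d + 2)) := by
    have h3 : Derives (tok x₁ d + tok y₀ d) 1 (tok (x₁ ⊓ y₀) (d + 1)) :=
      (Derives.and le_rfl le_rfl).trans (Derives.of_le (by rw [two_nsmul]; exact le_self_add))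
    exact ((Derives.refl (tok y₁ d)).add h3).trans (Derives.or (Nat.le_succ d) le_rfl)
  have h4 := ((h1.add h2).add (Derives.refl (tok x₀ d + tok y₀ d))).add
    (Derives.of_le (Multiset.zero_le (tok y₁ d)))
  refine h4.congr ?_ (by abel) le_rfl
  abel

/-- One step of the Brent–Kung recursion: adjacent positions are combined, the carries before
the pairs are computed, and from them the carries inside of the pairs. For `ε = 1`, there is an
additional unpaired position. -/
theorem CarryCircuit.double {m S D : ℕ} (h : CarryCircuit I m S D) (ε : ℕ) (hε : ε ≤ 1) :
    CarryCircuit I (2 * m + ε) (S + 6 * m + 2 * ε) (D + 4) := by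
  intro x y d
  have hfront : Derives (∑ i ∈ range m, ((2 • tok (x (2 * i)) d + 2 • tok (y (2 * i)) d) +
      (2 • tok (x (2 * i + 1)) d + 2 • tok (y (2 * i + 1)) d))) (3 * m)
      (∑ i ∈ range m, ((2 • tok (x (2 * i + 1) ⊓ x (2 * i)) (d + 2) +
        2 • tok (y (2 * i + 1) ⊔ (x (2 * i + 1) ⊓ y (2 * i))) (d + 2)) +
        (tok (x (2 * i)) d + tok (y (2 * i)) d))) :=
    Derives.sum_range (fun i _ => derives_pair _ _ _ _ d) (by omega)
  rw [sum_add_distrib (s := range m) (f := fun i => 2 • tok (x (2 * i + 1) ⊓ x (2 * i)) (d + 2) +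
    2 • tok (y (2 * i + 1) ⊔ (x (2 * i + 1) ⊓ y (2 * i))) (d + 2))] at hfront
  have hin := h (fun i => x (2 * i + 1) ⊓ x (2 * i))
    (fun i => y (2 * i + 1) ⊔ (x (2 * i + 1) ⊓ y (2 * i))) (d + 2)
  simp only [seqCarry_pair] at hin
  have hrep : Derives (∑ i ∈ range m, 2 • tok (seqCarry x y (2 * (i + 1))) (d + 2 + D)) m
      (∑ i ∈ range m, (tok (seqCarry x y (2 * (i + 1))) (d + 2 + D) +
        2 • tok (seqCarry x y (2 * i + 1 + 1)) (d + (D + 4)))) := by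
    refine Derives.sum_range (c := 1) (fun i _ => ?_) (by omega)
    have h1 : Derives (tok (seqCarry x y (2 * (i + 1))) (d + 2 + D)) 1
        (2 • tok (seqCarry x y (2 * i + 1 + 1)) (d + (D + 4))) :=
      Derives.rep.trans (Derives.two_tok_mono (by omega))
    rw [two_nsmul]
    exact ((Derives.refl _).add h1).mono (by omega)
  rw [sum_add_distrib] at hrep
  -- The carries before the pairs, and before the unpaired position.
  have hshift : Derives (∑ i ∈ range m, tok (seqCarry x y (2 * (i + 1))) (d + 2 + D)) 0
      (∑ i ∈ range (m + ε), tok (seqCarry x y (2 * i)) (d + 2 + D)) := by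
    have h1 := (Derives.refl (∑ i ∈ range m, tok (seqCarry x y (2 * (i + 1))) (d + 2 + D))).add
      (Derives.tok_bot (d := d + 2 + D))
    have h2 : tok (⊥ : (I → Bool) → Bool) (d + 2 + D) =
        tok (seqCarry x y (2 * 0)) (d + 2 + D) := rfl
    rw [add_zero, h2, ← sum_range_succ' (fun i => tok (seqCarry x y (2 * i)) (d + 2 + D))] at h1
    exact h1.trans (Derives.of_le (sum_le_sum_of_subset (range_mono (by omega))))
  have hback : Derives (∑ i ∈ range (m + ε), (tok (seqCarry x y (2 * i)) (d + 2 + D) +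
      (tok (x (2 * i)) d + tok (y (2 * i)) d))) (2 * (m + ε))
      (∑ i ∈ range (m + ε), 2 • tok (seqCarry x y (2 * i + 1)) (d + (D + 4))) := by
    refine Derives.sum_range (c := 2) (fun i _ => ?_) (by omega)
    have h1 : Derives (tok (x (2 * i)) d + tok (seqCarry x y (2 * i)) (d + 2 + D)) 1
        (tok (x (2 * i) ⊓ seqCarry x y (2 * i)) (d + 2 + D + 1)) :=
      (Derives.and (by omega) le_rfl).trans
        (Derives.of_le (by rw [two_nsmul]; exact le_self_add))
    refine (((Derives.refl (tok (y (2 * i)) d)).add h1).trans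
      (Derives.or (by omega) le_rfl)).congr (by abel) ?_ le_rfl
    congr 2
    omega
  have hlast : Derives (∑ i ∈ Ico m (m + ε), (2 • tok (x (2 * i)) d + 2 • tok (y (2 * i)) d)) 0
      (∑ i ∈ Ico m (m + ε), (tok (x (2 * i)) d + tok (y (2 * i)) d)) := by
    refine Derives.of_le (sum_le_sum fun i _ => ?_)
    rw [two_nsmul, two_nsmul]
    exact add_le_add le_self_add le_self_add
  have hE : ∑ i ∈ range m, (tok (x (2 * i)) d + tok (y (2 * i)) d) +
      ∑ i ∈ Ico m (m + ε), (tok (x (2 * i)) d + tok (y (2 * i)) d) =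
      ∑ i ∈ range (m + ε), (tok (x (2 * i)) d + tok (y (2 * i)) d) :=
    sum_range_add_sum_Ico _ (by omega)
  rw [sum_add_distrib] at hback
  have h1 := (hfront.add hlast).trans ((((hin.trans hrep).trans (hshift.add (Derives.refl _))).add
    (Derives.refl _)).congr (add_assoc _ _ _) rfl le_rfl)
  rw [hE] at h1
  have h2 := h1.trans (((hback.add (Derives.refl _)).congr (add_right_comm _ _ _) rfl le_rfl))
  refine h2.congr ?_ ?_ (by omega)
  · rw [← sum_range_two_mul fun i => 2 • tok (x i) d + 2 • tok (y i) d]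
    interval_cases ε
    · simp
    · simp [sum_range_succ]
  · interval_cases ε
    · rw [add_zero, add_zero, sum_range_two_mul, sum_add_distrib]
    · rw [sum_range_succ, sum_range_two_mul, sum_add_distrib, sum_range_succ]
      abel

theorem CarryCircuit.one : CarryCircuit I 1 0 0 := by
  intro x y d
  rw [sum_range_one, sum_range_one, zero_add, seqCarry_one, add_zero]
  exact Derives.of_le le_add_self

/-- The Brent–Kung recursion starting from a circuit for `n / 2 ^ q` positions. -/
theorem CarryCircuit.iterate {S D : ℕ} (q : ℕ) {n : ℕ} (hn : 2 ^ q ≤ n)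
    (h : CarryCircuit I (n / 2 ^ q) S D) :
    ∃ S', S' + 6 * (n / 2 ^ q) ≤ S + 6 * n ∧ CarryCircuit I n S' (D + 4 * q) := by
  induction q generalizing n with
  | zero => exact ⟨S, by simp, by simpa using h⟩
  | succ q ih =>
    have h2 : n / 2 ^ (q + 1) = n / 2 / 2 ^ q := by rw [pow_succ', Nat.div_div_eq_div_mul]
    obtain ⟨S', hS', h'⟩ := ih (n := n / 2) (by rw [pow_succ] at hn; omega) (h2 ▸ h)
    have h3 := h'.double (n % 2) (by omega)
    rw [Nat.div_add_mod] at h3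
    exact ⟨_, by rw [h2]; omega, h3⟩

theorem CarryCircuit.two_pow (k : ℕ) : CarryCircuit I (2 ^ k) (6 * 2 ^ k) (4 * k) := by
  have h1 : (2 ^ k) / 2 ^ k = 1 := Nat.div_self (by positivity)
  obtain ⟨S, hS, h⟩ := CarryCircuit.iterate (I := I) k (n := 2 ^ k) (S := 0) (D := 0) le_rfl
    (by rw [h1]; exact CarryCircuit.one)
  intro x y d
  rw [zero_add] at h
  exact (h x y d).mono (by omega)

/-! ### Prefix conjunctions and butterfly networks -/

/-- Conjunctions of all proper prefixes of a sequence of length `2 ^ k`. -/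
theorem derives_propagate (q : ℕ → (I → Bool) → Bool) (k d : ℕ) :
    Derives (∑ u ∈ range (2 ^ k), 2 • tok (q u) d) (3 * 2 ^ k)
      (∑ u ∈ range (2 ^ k), 2 • tok (propagate q u) (d + 2 * k)) := by
  induction k generalizing q d with
  | zero =>
    simp only [pow_zero, sum_range_one, propagate]
    refine ((Derives.of_le (Multiset.zero_le _)).trans (Derives.tok_top.nsmul 2)).congr rfl rfl ?_
    simp
  | succ k ih =>
    have hfront : Derives (∑ i ∈ range (2 ^ k), (2 • tok (q (2 * i)) d + 2 • tok (q (2 * i + 1)) d))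
        (2 ^ k) (∑ i ∈ range (2 ^ k), (2 • tok (q (2 * i) ⊓ q (2 * i + 1)) (d + 1) +
          tok (q (2 * i)) d)) := by
      refine Derives.sum_range (c := 1) (fun i _ => ?_) (by omega)
      have h1 : Derives (2 • tok (q (2 * i + 1)) d) 0 (tok (q (2 * i + 1)) d) :=
        Derives.of_le (by rw [two_nsmul]; exact le_self_add)
      have h2 := (h1.add (Derives.refl (tok (q (2 * i)) d))).trans
        ((Derives.and (f := q (2 * i)) (g := q (2 * i + 1)) (le_refl d) (le_refl d)).congr
          (add_comm _ _) rfl le_rfl)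
      refine (h2.add (Derives.refl (tok (q (2 * i)) d))).congr ?_ rfl le_rfl
      rw [two_nsmul (tok (q (2 * i)) d)]
      abel
    have hin := ih (fun i => q (2 * i) ⊓ q (2 * i + 1)) (d + 1)
    simp only [propagate_pair] at hin
    have hback : Derives (∑ i ∈ range (2 ^ k), (2 • tok (propagate q (2 * i)) (d + 1 + 2 * k) +
        tok (q (2 * i)) d)) (2 * 2 ^ k)
        (∑ i ∈ range (2 ^ k), (2 • tok (propagate q (2 * i)) (d + 2 * (k + 1)) +
          2 • tok (propagate q (2 * i + 1)) (d + 2 * (k + 1)))) := by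
      refine Derives.sum_range (c := 2) (fun i _ => ?_) (by omega)
      have h1 := (Derives.rep (f := propagate q (2 * i)) (d := d + 1 + 2 * k)).add
        (Derives.and (f := propagate q (2 * i)) (g := q (2 * i)) (le_refl (d + 1 + 2 * k))
          (show d ≤ d + 1 + 2 * k by omega))
      refine h1.congr ?_ ?_ le_rfl
      · rw [two_nsmul]
        abel
      · rw [show d + 1 + 2 * k + 1 = d + 2 * (k + 1) by ring]
        rfl
    rw [sum_add_distrib (f := fun i => 2 • tok (q (2 * i) ⊓ q (2 * i + 1)) (d + 1))] at hfront
    rw [sum_add_distrib] at hback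
    have h1 := hfront.trans ((hin.add (Derives.refl _)).trans hback)
    rw [pow_succ', sum_range_two_mul, sum_range_two_mul]
    exact h1.congr rfl rfl (by omega)

/-- A butterfly network: fan-in and fan-out two in each of the `k` layers suffice to
compute `2 ^ k` times the combination of all elements of a sequence of length `2 ^ k`. Here `F`
combines an initial segment of a sequence by means of the operation `op`. -/
theorem derives_butterfly {op : ((I → Bool) → Bool) → ((I → Bool) → Bool) → (I → Bool) → Bool}
    (hop : ∀ f g d, Derives (tok f d + tok g d) 1 (2 • tok (op f g) (d + 1)))
    {F : (ℕ → (I → Bool) → Bool) → ℕ → (I → Bool) → Bool} (hF1 : ∀ t, F t 1 = t 0)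
    (hF : ∀ t a b, F t (a + b) = op (F t a) (F (fun i => t (a + i)) b))
    (t : ℕ → (I → Bool) → Bool) (k d : ℕ) :
    Derives (∑ u ∈ range (2 ^ k), 2 • tok (t u) d) (k * 2 ^ k)
      (2 ^ k • 2 • tok (F t (2 ^ k)) (d + k)) := by
  induction k generalizing t with
  | zero =>
    simp only [pow_zero, sum_range_one, hF1, one_nsmul, add_zero, zero_mul]
    exact Derives.refl _
  | succ k ih =>
    rw [pow_succ, Nat.mul_two, sum_range_add, hF]
    have h1 := ((ih t).add (ih fun i => t (2 ^ k + i))).trans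
      (((hop (F t (2 ^ k)) (F (fun i => t (2 ^ k + i)) (2 ^ k)) (d + k)).nsmul (2 ^ k * 2)).congr
        ?_ rfl le_rfl)
    · refine h1.congr rfl ?_ (le_of_eq (by ring))
      rw [← add_assoc d k 1, mul_two]
    · rw [nsmul_add, mul_nsmul', mul_nsmul']

theorem derives_propagate_total (q : ℕ → (I → Bool) → Bool) (k d : ℕ) :
    Derives (∑ u ∈ range (2 ^ k), 2 • tok (q u) d) (k * 2 ^ k)
      (2 ^ k • 2 • tok (propagate q (2 ^ k)) (d + k)) :=
  derives_butterfly (op := (· ⊓ ·)) (fun _ _ _ => Derives.and le_rfl le_rfl) propagate_one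
    propagate_add q k d

theorem derives_sup_total (t : ℕ → (I → Bool) → Bool) (k d : ℕ) :
    Derives (∑ u ∈ range (2 ^ k), 2 • tok (t u) d) (k * 2 ^ k)
      (2 ^ k • 2 • tok ((range (2 ^ k)).sup t) (d + k)) :=
  derives_butterfly (op := (· ⊔ ·)) (F := fun t n => (range n).sup t)
    (fun _ _ _ => Derives.or le_rfl le_rfl) (fun t => by simp) sup_range_add t k d

end Circuits

/-! ### One level of the butterfly construction -/

section Circuits

open Finset

variable {I : Type}

theorem Derives.tok_of_two_tok {f : (I → Bool) → Bool} {d : ℕ} :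
    Derives (2 • tok f d) 0 (tok f d) :=
  Derives.of_le (by rw [two_nsmul]; exact le_self_add)

theorem Derives.rep_two {f : (I → Bool) → Bool} {d : ℕ} :
    Derives (2 • tok f d) 2 (2 • tok f (d + 1) + 2 • tok f (d + 1)) := by
  have := (Derives.rep (f := f) (d := d)).nsmul 2
  rwa [two_nsmul (2 • tok f (d + 1))] at this

variable (q t a c : ℕ → (I → Bool) → Bool) (k : ℕ)

/-- Eight tokens from two: the butterfly network must not be delayed by more than one repeater,
while three pairs of tokens, for the masks, the prefixes and the carries, may come later. -/
theorem derives_copies (d : ℕ) :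
    Derives (∑ u ∈ range (2 ^ k), 2 • tok (q u) d) (6 * 2 ^ k)
      (∑ u ∈ range (2 ^ k), 2 • tok (q u) (d + 1) + (∑ u ∈ range (2 ^ k), 2 • tok (q u) (d + 3) +
        (∑ u ∈ range (2 ^ k), 2 • tok (q u) (d + 3) +
          ∑ u ∈ range (2 ^ k), 2 • tok (q u) (d + 3)))) := by
  rw [← sum_add_distrib, ← sum_add_distrib, ← sum_add_distrib]
  refine Derives.sum_range (c := 6) (fun u _ => ?_) (by omega)
  have h1 : Derives (2 • tok (q u) (d + 1)) 4
      (2 • tok (q u) (d + 3) + (2 • tok (q u) (d + 3) + 2 • tok (q u) (d + 3))) :=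
    Derives.rep_two.trans ((Derives.two_tok_mono (Nat.le_succ _)).add Derives.rep_two)
  exact (Derives.rep_two.trans ((Derives.refl _).add h1)).mono (by omega)

theorem derives_update_propagate {tQ tQ' d : ℕ} (h1 : tQ + 1 ≤ tQ') (h2 : d + 2 * k + 1 ≤ tQ') :
    Derives (∑ u ∈ range (2 ^ k), 2 • tok (q u) d + ∑ u ∈ range (2 ^ k), 2 • tok (a u) tQ)
      (4 * 2 ^ k) (∑ u ∈ range (2 ^ k), 2 • tok (a u ⊓ propagate q u) tQ' +
        ∑ u ∈ range (2 ^ k), tok (a u) tQ) := by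
  refine ((derives_propagate q k d).add (Derives.refl _)).trans ?_ |>.mono
    (a := 3 * 2 ^ k + 0 + 2 ^ k) (by omega)
  rw [← sum_add_distrib, ← sum_add_distrib]
  refine Derives.sum_range (c := 1) (fun u _ => ?_) (by omega)
  have h3 : Derives (tok (a u) tQ + tok (propagate q u) (d + 2 * k)) 1
      (2 • tok (a u ⊓ propagate q u) tQ') :=
    (Derives.and (c := tQ' - 1) (by omega) (by omega)).trans (Derives.two_tok_mono (by omega))
  have h4 : Derives (2 • tok (propagate q u) (d + 2 * k)) 0 (tok (propagate q u) (d + 2 * k)) :=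
    Derives.tok_of_two_tok
  refine ((h4.add (Derives.refl (2 • tok (a u) tQ))).trans
    ((h3.add (Derives.refl (tok (a u) tQ))).congr ?_ rfl le_rfl)).mono (by omega)
  rw [two_nsmul (tok (a u) tQ)]
  abel

/-- The carry generated by `2 ^ k` blocks is the disjunction of the carries `t u` generated by the
blocks, each masked by the propagate bits `q` of the blocks behind. If the masks are available
early, then only one conjunction adds to the depth of the butterfly network. -/
theorem derives_total {tT d : ℕ} (h : d + 2 * k ≤ tT) :
    Derives (∑ u ∈ range (2 ^ k), 2 • tok (q u) d + ∑ u ∈ range (2 ^ k), 2 • tok (t u) tT)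
      ((k + 5) * 2 ^ k) (∑ _u ∈ range (2 ^ k), 2 • tok (seqCarry q t (2 ^ k)) (tT + 1 + k) +
        ∑ u ∈ range (2 ^ k), 2 • tok (t u) (tT + 1)) := by
  have hmask := derives_propagate (fun i => q (2 ^ k - 1 - i)) k d
  rw [sum_range_reflect (fun u => 2 • tok (q u) d), ← sum_range_reflect
    (fun u => 2 • tok (propagate (fun i => q (2 ^ k - 1 - i)) u) (d + 2 * k))] at hmask
  have h1 : Derives (∑ u ∈ range (2 ^ k),
      (2 • tok (propagate (fun i => q (2 ^ k - 1 - i)) (2 ^ k - 1 - u)) (d + 2 * k) +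
        2 • tok (t u) tT)) (2 * 2 ^ k)
      (∑ u ∈ range (2 ^ k),
        (2 • tok (t u ⊓ propagate (fun i => q (2 ^ k - 1 - i)) (2 ^ k - 1 - u)) (tT + 1) +
          2 • tok (t u) (tT + 1))) := by
    refine Derives.sum_range (c := 2) (fun u _ => ?_) (by omega)
    have h2 := (Derives.and (c := tT) (f := t u) (le_refl tT)
      (g := propagate (fun i => q (2 ^ k - 1 - i)) (2 ^ k - 1 - u)) h).add
        (Derives.rep (f := t u) (d := tT))
    refine ((Derives.tok_of_two_tok.add (Derives.refl (2 • tok (t u) tT))).trans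
      (h2.congr ?_ rfl le_rfl))
    rw [two_nsmul]
    abel
  rw [sum_add_distrib, sum_add_distrib] at h1
  have h2 := (derives_sup_total
    (fun u => t u ⊓ propagate (fun i => q (2 ^ k - 1 - i)) (2 ^ k - 1 - u)) k (tT + 1))
  rw [seqCarry_eq_sup] at h2
  refine ((hmask.add (Derives.refl _)).trans (h1.trans (h2.add (Derives.refl _)))).congr rfl ?_ ?_
  · simp
  · apply le_of_eq; ring

/-- The carries before the blocks are computed by a Brent–Kung circuit. -/
theorem derives_carries {tT d : ℕ} (h : d ≤ tT) :
    Derives (∑ u ∈ range (2 ^ k), 2 • tok (q u) d + ∑ u ∈ range (2 ^ k), 2 • tok (t u) tT)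
      (6 * 2 ^ k) (∑ u ∈ range (2 ^ k), tok (seqCarry q t u) (tT + 4 * k)) := by
  have h1 : Derives (∑ u ∈ range (2 ^ k), 2 • tok (q u) d) 0
      (∑ u ∈ range (2 ^ k), 2 • tok (q u) tT) :=
    Derives.sum_range (c := 0) (fun _ _ => Derives.two_tok_mono h) (by omega)
  have h2 := CarryCircuit.two_pow k q t tT
  rw [sum_add_distrib] at h2
  have h3 : Derives (∑ u ∈ range (2 ^ k), 2 • tok (seqCarry q t (u + 1)) (tT + 4 * k)) 0
      (∑ u ∈ range (2 ^ k), tok (seqCarry q t (u + 1)) (tT + 4 * k)) :=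
    Derives.sum_range (c := 0) (fun u _ => Derives.tok_of_two_tok) (by omega)
  have h4 := ((h1.add (Derives.refl _)).trans (h2.trans h3)).add
    (Derives.tok_bot (d := tT + 4 * k))
  have h5 : tok (⊥ : (I → Bool) → Bool) (tT + 4 * k) = tok (seqCarry q t 0) (tT + 4 * k) := rfl
  rw [h5, ← sum_range_succ' (fun u => tok (seqCarry q t u) (tT + 4 * k)), add_zero] at h4
  exact (h4.trans (Derives.of_le (sum_le_sum_of_subset (range_mono (Nat.le_succ _))))).mono
    (by omega)

/-- The carries before the positions: the carry `t u` before the block is propagated to the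
position, or there is a carry `c u` from within the block. -/
theorem derives_update_seqCarry {tQ tC tC' d : ℕ} (h1 : tQ + 2 ≤ tC') (h2 : tC + 1 ≤ tC')
    (h3 : d + 2 ≤ tC') :
    Derives (∑ u ∈ range (2 ^ k), tok (t u) d + (∑ u ∈ range (2 ^ k), tok (a u) tQ +
      ∑ u ∈ range (2 ^ k), 2 • tok (c u) tC)) (2 * 2 ^ k)
      (∑ u ∈ range (2 ^ k), 2 • tok (c u ⊔ (t u ⊓ a u)) tC') := by
  rw [← sum_add_distrib, ← sum_add_distrib]
  refine Derives.sum_range (c := 2) (fun u _ => ?_) (by omega)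
  have h4 : Derives (tok (t u) d + tok (a u) tQ) 1 (tok (t u ⊓ a u) (tC' - 1)) :=
    ((Derives.and (c := tC' - 2) (by omega) (by omega)).trans
      Derives.tok_of_two_tok).trans (Derives.tok_mono (by omega))
  have h5 : Derives (tok (c u) tC + tok (t u ⊓ a u) (tC' - 1)) 1
      (2 • tok (c u ⊔ (t u ⊓ a u)) tC') :=
    (Derives.or (c := tC' - 1) (by omega) (by omega)).trans (Derives.two_tok_mono (by omega))
  exact ((h4.add (Derives.tok_of_two_tok (f := c u) (d := tC))).trans
    (h5.congr (add_comm _ _) rfl le_rfl)).congr (by abel) rfl (by omega)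

/-- One level of the construction, for one position in each of `2 ^ k` consecutive blocks. For
the block `u`, the tokens provide the conjunction `q u` of its propagate bits, the carry `t u`
generated by it, and, for the position inside of the block, the conjunction `a u` of the propagate
bits and the carry `c u` generated before the position within the block. The result are the
corresponding tokens for the union of the blocks. -/
theorem derives_level {tP tT tQ tC tQ' tC' : ℕ} (hT : tP + 2 * k + 3 ≤ tT) (hQ : tQ + 1 ≤ tQ')
    (hQ' : tP + 2 * k + 4 ≤ tQ') (hC : tC + 1 ≤ tC') (hC' : tQ + 2 ≤ tC')
    (hC'' : tT + 4 * k + 3 ≤ tC') :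
    Derives (∑ u ∈ range (2 ^ k), (2 • tok (q u) tP + 2 • tok (t u) tT +
        (2 • tok (a u) tQ + 2 • tok (c u) tC))) ((2 * k + 23) * 2 ^ k)
      (∑ u ∈ range (2 ^ k), (2 • tok (propagate q (2 ^ k)) (tP + k + 1) +
        2 • tok (seqCarry q t (2 ^ k)) (tT + k + 1) +
        (2 • tok (a u ⊓ propagate q u) tQ' + 2 • tok (c u ⊔ (seqCarry q t u ⊓ a u)) tC'))) := by
  -- The butterflies cost `2 * k` gates per position, and the remaining steps `23`: `6` for copies,
  -- `4` for prefixes, `5` for masks and copies of `t`, `6` for carries and `2` for their update.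
  have h1 := derives_copies q k tP
  have h2 := derives_propagate_total q k (tP + 1)
  have h3 := derives_update_propagate q a k (d := tP + 3) hQ (by omega)
  have h4 := derives_total q t k (d := tP + 3) (tT := tT) (by omega)
  have h5 := derives_carries q t k (d := tP + 3) (tT := tT + 1) (by omega)
  have h6 := derives_update_seqCarry (seqCarry q t) a c k (d := tT + 1 + 4 * k) hC' hC (by omega)
  have h7 := (h1.add (Derives.refl (∑ u ∈ range (2 ^ k), 2 • tok (t u) tT +
      (∑ u ∈ range (2 ^ k), 2 • tok (a u) tQ + ∑ u ∈ range (2 ^ k), 2 • tok (c u) tC)))).trans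
    (((h2.add (h3.add (h4.add (Derives.refl (∑ u ∈ range (2 ^ k), 2 • tok (q u) (tP + 3) +
      ∑ u ∈ range (2 ^ k), 2 • tok (c u) tC)))))).congr (by abel) rfl le_rfl)
  have h8 := h7.trans ((((Derives.refl _).add h5).trans (((Derives.refl
    (2 ^ k • 2 • tok (propagate q (2 ^ k)) (tP + 1 + k) +
      (∑ u ∈ range (2 ^ k), 2 • tok (seqCarry q t (2 ^ k)) (tT + 1 + k) +
      ∑ u ∈ range (2 ^ k), 2 • tok (a u ⊓ propagate q u) tQ'))).add h6).congr
        (A' := (2 ^ k • 2 • tok (propagate q (2 ^ k)) (tP + 1 + k) +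
      (∑ u ∈ range (2 ^ k), 2 • tok (seqCarry q t (2 ^ k)) (tT + 1 + k) +
      ∑ u ∈ range (2 ^ k), 2 • tok (a u ⊓ propagate q u) tQ') +
        ∑ u ∈ range (2 ^ k), tok (a u) tQ + ∑ u ∈ range (2 ^ k), 2 • tok (c u) tC) +
        ∑ u ∈ range (2 ^ k), tok (seqCarry q t u) (tT + 1 + 4 * k)) (by abel) rfl le_rfl)).congr
          (by abel) rfl le_rfl)
  refine h8.congr ?_ ?_ (le_of_eq (by ring))
  · simp only [sum_add_distrib]
    abel
  · simp only [sum_add_distrib, sum_const, card_range, add_right_comm _ k 1]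
    abel

end Circuits

/-! ### The circuits for all lengths -/

section Circuits

open Finset

variable {I : Type}

/-- The iterated construction: on each of `i` levels, at most `2 ^ s` blocks are merged to one. -/
theorem derives_levels (s d i : ℕ) {K : ℕ} (hK : K ≤ i * s) (x y : ℕ → (I → Bool) → Bool) :
    Derives (∑ p ∈ range (2 ^ K), (2 • tok (x p) d + 2 • tok (y p) d))
      ((2 * K + 23 * i) * 2 ^ K)
      (∑ p ∈ range (2 ^ K), (2 • tok (propagate x (2 ^ K)) (d + K + i) +
        2 • tok (seqCarry x y (2 ^ K)) (d + K + i + 2 * s + 3) +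
        (2 • tok (propagate x p) (d + K + i + s + 3) +
          2 • tok (seqCarry x y p) (d + K + i + 5 * s + 5)))) := by
  induction i generalizing K x y with
  | zero =>
    obtain rfl : K = 0 := by omega
    simp only [pow_zero, sum_range_one, propagate_one, seqCarry_one]
    have h1 : Derives (0 : Multiset (Token I)) 0 (2 • tok (propagate x 0) (d + 0 + 0 + s + 3)) :=
      (Derives.tok_top.nsmul 2).congr rfl rfl (by simp)
    have h2 : Derives (0 : Multiset (Token I)) 0
        (2 • tok (seqCarry x y 0) (d + 0 + 0 + 5 * s + 5)) :=
      (Derives.tok_bot.nsmul 2).congr rfl rfl (by simp)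
    have h3 : Derives (2 • tok (y 0) d) 0 (2 • tok (y 0) (d + 0 + 0 + 2 * s + 3)) :=
      Derives.two_tok_mono (by omega)
    exact (((Derives.refl (2 • tok (x 0) d)).add h3).add (h1.add h2)).congr (by simp) rfl (by simp)
  | succ i ih =>
    obtain ⟨k, K', hk, hK', rfl⟩ : ∃ k K', k ≤ s ∧ K' ≤ i * s ∧ K = k + K' :=
      ⟨min K s, K - min K s, min_le_right _ _, by rw [Nat.succ_mul] at hK; omega, by omega⟩
    have h1 := Derives.sum_range (n := 2 ^ k) (fun u _ => ih hK'
      (fun p => x (u * 2 ^ K' + p)) (fun p => y (u * 2 ^ K' + p))) le_rfl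
    rw [sum_comm (s := range (2 ^ k)) (t := range (2 ^ K')) (f := fun u p =>
      2 • tok (propagate (fun p => x (u * 2 ^ K' + p)) (2 ^ K')) (d + K' + i) + _ + _)] at h1
    have h2 := Derives.sum_range (n := 2 ^ K') (fun p _ => derives_level
      (fun u => propagate (fun p => x (u * 2 ^ K' + p)) (2 ^ K'))
      (fun u => seqCarry (fun p => x (u * 2 ^ K' + p)) (fun p => y (u * 2 ^ K' + p)) (2 ^ K'))
      (fun u => propagate (fun p => x (u * 2 ^ K' + p)) p)
      (fun u => seqCarry (fun p => x (u * 2 ^ K' + p)) (fun p => y (u * 2 ^ K' + p)) p) k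
      (tP := d + K' + i) (tT := d + K' + i + 2 * s + 3) (tQ := d + K' + i + s + 3)
      (tC := d + K' + i + 5 * s + 5) (tQ' := d + (k + K') + (i + 1) + s + 3)
      (tC' := d + (k + K') + (i + 1) + 5 * s + 5) (by omega) (by omega) (by omega) (by omega)
      (by omega) (by omega)) le_rfl
    refine (h1.trans h2).congr ?_ ?_ (le_of_eq (by ring))
    · rw [pow_add, sum_range_mul]
    · rw [pow_add, sum_range_mul, sum_comm]
      refine sum_congr rfl fun p _ => sum_congr rfl fun u _ => ?_
      rw [propagate_block, seqCarry_block, propagate_block, seqCarry_block, ← seqCarry_add,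
        inf_comm, ← propagate_add]
      congr 4 <;> omega

theorem seqCarry_congr {α : Type*} [DistribLattice α] [BoundedOrder α] {x y x' y' : ℕ → α} {n : ℕ}
    (hx : ∀ i < n, x i = x' i) (hy : ∀ i < n, y i = y' i) : seqCarry x y n = seqCarry x' y' n := by
  induction n with
  | zero => rfl
  | succ n ih =>
    rw [seqCarry, seqCarry, ih (fun i hi => hx i (by omega)) (fun i hi => hy i (by omega)),
      hx n (by omega), hy n (by omega)]

/-- A circuit of depth close to `K` whose size exceeds `2 ^ K` by a factor of about `2 * K`. The
numbers of levels `a` and `s` can be chosen freely. The input is extended to length `2 ^ K` by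
constants, which do not require gates. -/
theorem CarryCircuit.of_levels {a s K n : ℕ} (hK : K ≤ a * s) (hn : n < 2 ^ K) :
    CarryCircuit I n ((2 * K + 23 * a) * 2 ^ K) (K + a + 5 * s + 5) := by
  intro x y d
  set x' : ℕ → (I → Bool) → Bool := fun p => if p < n then x p else ⊥ with hx'
  set y' : ℕ → (I → Bool) → Bool := fun p => if p < n then y p else ⊥ with hy'
  have hpad : Derives (∑ i ∈ range n, (2 • tok (x i) d + 2 • tok (y i) d)) 0
      (∑ i ∈ range (2 ^ K), (2 • tok (x' i) d + 2 • tok (y' i) d)) := by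
    rw [← sum_range_add_sum_Ico _ hn.le]
    have h1 : ∑ i ∈ range n, (2 • tok (x i) d + 2 • tok (y i) d) =
        ∑ i ∈ range n, (2 • tok (x' i) d + 2 • tok (y' i) d) :=
      sum_congr rfl fun i hi => by simp [hx', hy', mem_range.1 hi]
    have h2 : Derives (∑ i ∈ Ico n (2 ^ K), 0) (∑ i ∈ Ico n (2 ^ K), 0)
        (∑ i ∈ Ico n (2 ^ K), (2 • tok (x' i) d + 2 • tok (y' i) d)) := by
      refine Derives.sum _ fun i hi => ?_
      have hi : ¬i < n := by have := mem_Ico.1 hi; omega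
      have h3 : Derives (0 : Multiset (Token I)) 0 (2 • tok ⊥ d) :=
        (Derives.tok_bot.nsmul 2).congr rfl rfl (by simp)
      simpa [hx', hy', hi] using h3.add h3
    rw [h1]
    exact ((Derives.refl _).add h2).congr (by simp) rfl (by simp)
  have hout : Derives (∑ p ∈ range (2 ^ K), (2 • tok (propagate x' (2 ^ K)) (d + K + a) +
        2 • tok (seqCarry x' y' (2 ^ K)) (d + K + a + 2 * s + 3) +
        (2 • tok (propagate x' p) (d + K + a + s + 3) +
          2 • tok (seqCarry x' y' p) (d + K + a + 5 * s + 5)))) 0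
      (∑ i ∈ range n, 2 • tok (seqCarry x y (i + 1)) (d + (K + a + 5 * s + 5))) := by
    refine Derives.of_le ?_
    have h1 : ∑ i ∈ range n, 2 • tok (seqCarry x y (i + 1)) (d + (K + a + 5 * s + 5)) =
        ∑ i ∈ range n, 2 • tok (seqCarry x' y' (i + 1)) (d + K + a + 5 * s + 5) := by
      refine sum_congr rfl fun i hi => ?_
      have hi := mem_range.1 hi
      rw [seqCarry_congr (x' := x') (y' := y'),
        show d + (K + a + 5 * s + 5) = d + K + a + 5 * s + 5 by omega]
      · intro j hj
        simp [hx', show j < n by omega]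
      · intro j hj
        simp [hy', show j < n by omega]
    rw [h1]
    refine le_trans ?_ (sum_le_sum fun p _ => le_add_self.trans le_add_self)
    refine le_trans ?_ (sum_le_sum_of_subset (range_mono hn))
    rw [sum_range_succ' (fun i => 2 • tok (seqCarry x' y' i) (d + K + a + 5 * s + 5))]
    exact le_self_add
  exact (hpad.trans ((derives_levels s d a hK x' y').trans hout)).mono (by omega)

/-- For `2 ^ 16` positions, the Brent–Kung recursion has depth `64`, which exceeds the bound
`62`. -/
theorem exists_carryCircuit_two_pow_sixteen :
    ∃ S, 2 * S ≤ 19 * 2 ^ 16 ∧ CarryCircuit I (2 ^ 16) S 59 := by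
  have h1 : CarryCircuit I 1024 ((2 * 11 + 23 * 4) * 2 ^ 11) 35 :=
    CarryCircuit.of_levels (s := 3) (by norm_num) (by norm_num)
  obtain ⟨S, hS, h⟩ := CarryCircuit.iterate 6 (n := 2 ^ 16) (by norm_num)
    (show CarryCircuit I (2 ^ 16 / 2 ^ 6) ((2 * 11 + 23 * 4) * 2 ^ 11) 35 by norm_num; exact h1)
  exact ⟨S, by omega, h⟩

/-- The bounds in terms of integers; the assumptions on `s` are those satisfied by
`⌈√(log₂ n)⌉`. -/
theorem exists_carryCircuit {n s : ℕ} (hn : 1 ≤ n) (hs : n ≤ 2 ^ (s * s))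
    (hs' : 2 ^ ((s - 1) * (s - 1)) ≤ n) :
    ∃ S D, 2 * S ≤ 19 * n ∧ D ≤ Nat.log 2 n + 8 * s + 6 * Nat.clog 2 s + 2 ∧
      CarryCircuit I n S D := by
  have hlog : 2 ^ Nat.log 2 n ≤ n := Nat.pow_log_le_self 2 (by omega)
  have hlog' : n < 2 ^ (Nat.log 2 n + 1) := Nat.lt_pow_succ_log_self (by norm_num) n
  have hL : Nat.log 2 n ≤ s * s :=
    (Nat.log_mono_right hs).trans (Nat.log_pow (by norm_num) _).le
  have hL' : (s - 1) * (s - 1) ≤ Nat.log 2 n :=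
    (Nat.log_pow (by norm_num) _).symm.le.trans (Nat.log_mono_right hs')
  have hT : s ≤ 2 ^ Nat.clog 2 s := Nat.le_pow_clog (by norm_num) s
  have hTle : 1 < s → Nat.clog 2 s ≤ s - 1 := by
    intro h
    have h1 := Nat.pow_pred_clog_lt_self (b := 2) (by norm_num) h
    have h2 : (Nat.clog 2 s).pred < 2 ^ (Nat.clog 2 s).pred := Nat.lt_two_pow_self
    have h3 := Nat.pred_eq_sub_one (n := Nat.clog 2 s)
    omega
  generalize Nat.clog 2 s = T at hT hTle ⊢
  by_cases hs5 : 5 ≤ s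
  · have hTs := hTle (by omega)
    have hsq : 2 * s ≤ (s - 1) * (s - 1) := by
      obtain ⟨r, rfl⟩ := Nat.exists_eq_add_of_le hs5
      simp only [show 5 + r - 1 = r + 4 by omega]
      nlinarith
    obtain ⟨L, hLq⟩ : ∃ L, Nat.log 2 n + 1 = L + (2 * T + 2) :=
      ⟨Nat.log 2 n + 1 - (2 * T + 2), by omega⟩
    have hdiv : n / 2 ^ (2 * T + 2) < 2 ^ L := by
      rw [Nat.div_lt_iff_lt_mul (by positivity), ← pow_add, ← hLq]
      exact hlog'
    have h1 : CarryCircuit I (n / 2 ^ (2 * T + 2)) ((2 * L + 23 * s) * 2 ^ L)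
        (L + s + 5 * s + 5) := CarryCircuit.of_levels (by omega) hdiv
    have hpow : 2 ^ (2 * T + 2) ≤ n := (Nat.pow_le_pow_right (by norm_num) (by omega)).trans hlog
    obtain ⟨S, hS, h⟩ := h1.iterate (2 * T + 2) hpow
    refine ⟨S, _, ?_, ?_, h⟩
    · have h2 : 2 ^ L * 2 ^ (2 * T + 2) ≤ 2 * n := by
        rw [← pow_add, ← hLq, pow_succ]
        omega
      have h3 : 4 * (s * s) ≤ 2 ^ (2 * T + 2) := by
        have : 2 ^ (2 * T + 2) = 4 * (2 ^ T * 2 ^ T) := by ring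
        rw [this]
        exact Nat.mul_le_mul_left 4 (Nat.mul_le_mul hT hT)
      have h4 : 2 * (4 * L + 46 * s) ≤ 7 * 2 ^ (2 * T + 2) := by nlinarith
      have h5 : 2 * ((2 * L + 23 * s) * 2 ^ L) ≤ 7 * n := by
        refine Nat.le_of_mul_le_mul_right (c := 2 ^ (2 * T + 2)) ?_ (by positivity)
        calc 2 * ((2 * L + 23 * s) * 2 ^ L) * 2 ^ (2 * T + 2)
            = (4 * L + 46 * s) * (2 ^ L * 2 ^ (2 * T + 2)) := by ring
          _ ≤ (4 * L + 46 * s) * (2 * n) := Nat.mul_le_mul_left _ h2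
          _ = (2 * (4 * L + 46 * s)) * n := by ring
          _ ≤ (7 * 2 ^ (2 * T + 2)) * n := Nat.mul_le_mul_right _ h4
          _ = 7 * n * 2 ^ (2 * T + 2) := by ring
      omega
    · omega
  · by_cases h16 : Nat.log 2 n = 16
    · have hs4 : s = 4 := by
        have : s ≤ 4 := by omega
        rw [h16] at hL
        interval_cases s <;> omega
      subst hs4
      have hn16 : n = 2 ^ 16 := le_antisymm hs (h16 ▸ hlog)
      have hT2 : 2 ≤ T := by
        by_contra hT0
        have : T = 0 ∨ T = 1 := by omega
        rcases this with rfl | rfl <;> omega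
      obtain ⟨S, hS, h⟩ := exists_carryCircuit_two_pow_sixteen (I := I)
      refine ⟨S, 59, ?_, by omega, hn16 ▸ h⟩
      rw [hn16]
      exact hS
    · have h1 : n / 2 ^ Nat.log 2 n = 1 :=
        Nat.div_eq_of_lt_le (by omega) (by rw [pow_succ] at hlog'; omega)
      obtain ⟨S, hS, h⟩ := CarryCircuit.iterate (I := I) (Nat.log 2 n) (S := 0) (D := 0) hlog
        (by rw [h1]; exact CarryCircuit.one)
      refine ⟨S, _, by omega, ?_, h⟩
      have hT1 : 2 ≤ s → 1 ≤ T := by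
        intro h
        by_contra hT0
        obtain rfl : T = 0 := by omega
        omega
      have hT2 : 3 ≤ s → 2 ≤ T := by
        intro h
        by_contra hT0
        have : T = 0 ∨ T = 1 := by omega
        rcases this with rfl | rfl <;> omega
      have : s ≤ 4 := by omega
      interval_cases s <;> omega

end Circuits

/-! ### From carry circuits to adders -/

section Main

open Finset

theorem seqCarry_apply_elim {n : ℕ} {x y : ℕ → (Fin n ⊕ Fin n → Bool) → Bool} {X Y : Fin n → Bool}
    (hx : ∀ i : Fin n, x i (Sum.elim X Y) = X i) (hy : ∀ i : Fin n, y i (Sum.elim X Y) = Y i)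
    (j : Fin (n + 1)) : seqCarry x y j (Sum.elim X Y) = carry X Y j := by
  induction j using Fin.induction with
  | zero => rfl
  | succ i ih =>
    rw [carry, Fin.induction_succ, ← carry, ← ih, ← hx, ← hy]
    rfl

/-- The inputs of the circuit provide the propagate and generate bits; at positions from `n` on,
they are set to `false`. -/
theorem CarryCircuit.exists_isAdder {n S D : ℕ} (hn : 1 ≤ n)
    (h : CarryCircuit (Fin n ⊕ Fin n) n S D) :
    ∃ C : LogicCircuit (Fin n ⊕ Fin n) (Fin n),
      C.IsAdder ∧ (∀ v, C.fanOut v ≤ 2) ∧ C.size ≤ S ∧ C.depth ≤ D := by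
  have : Nonempty (Fin n) := ⟨⟨0, hn⟩⟩
  set x : ℕ → (Fin n ⊕ Fin n → Bool) → Bool := fun i v =>
    if h : i < n then v (Sum.inl ⟨i, h⟩) else false with hx
  set y : ℕ → (Fin n ⊕ Fin n → Bool) → Bool := fun i v =>
    if h : i < n then v (Sum.inr ⟨i, h⟩) else false with hy
  have hcry : ∀ (X Y : Fin n → Bool) (i : Fin n),
      seqCarry x y (i + 1) (Sum.elim X Y) = carry X Y i.succ := fun X Y i =>
    seqCarry_apply_elim (fun i => by simp [hx]) (fun i => by simp [hy]) i.succ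
  have hin := realizable_inputs (I := Fin n ⊕ Fin n) (D := D)
  have hsum : ∑ i : Fin n ⊕ Fin n, 2 • tok (fun v : Fin n ⊕ Fin n → Bool => v i) 0 =
      ∑ i ∈ range n, (2 • tok (x i) 0 + 2 • tok (y i) 0) + 0 := by
    rw [Fintype.sum_sum_type, add_zero, sum_add_distrib, sum_range, sum_range]
    simp [hx, hy]
  rw [hsum] at hin
  have hout := h x y 0 D 0 0 hin
  have hle : Derives (∑ i ∈ range n, 2 • tok (seqCarry x y (i + 1)) (0 + D)) 0
      (∑ i : Fin n, tok (seqCarry x y (i + 1)) D) := by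
    rw [sum_range, zero_add]
    exact Derives.of_le (sum_le_sum fun i _ => by rw [two_nsmul]; exact le_self_add)
  have hout' := hle D 0 _ hout
  rw [add_zero] at hout'
  -- No carry is constant: it is `true` for the input `1 … 1` and `false` for the input `0 … 0`.
  obtain ⟨C, hC, hfan, hsize, hdepth⟩ := hout'.exists_circuit fun i => by
    constructor
    · intro h0
      have h1 := hcry (fun _ => true) (fun _ => true) i
      rw [h0, carry, Fin.induction_succ] at h1
      simp at h1
    · intro h0
      have h1 : ∀ j : Fin (n + 1), carry (fun _ => false) (fun _ => false) j = false := by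
        intro j
        induction j using Fin.induction with
        | zero => rfl
        | succ i ih =>
          rw [carry, Fin.induction_succ]
          simp
      have h2 := hcry (fun _ => false) (fun _ => false) i
      rw [h0, h1] at h2
      simp at h2
  exact ⟨C, fun X Y i => (hC _ i).trans (hcry X Y i), hfan, by omega, hdepth⟩

end Main

theorem mainTheorem2 (n : ℕ) (hn : 1 ≤ n) :
    ∃ C : LogicCircuit (Fin n ⊕ Fin n) (Fin n),
      C.IsAdder ∧
      (∀ v, C.fanOut v ≤ 2) ∧
      (C.size : ℝ) ≤ 13.5 * (n : ℝ) ∧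
      (4096 ≤ n → (C.size : ℝ) ≤ 9.5 * (n : ℝ)) ∧
      (C.depth : ℝ) ≤ Real.logb 2 (n : ℝ) + 8 * (⌈Real.sqrt (Real.logb 2 (n : ℝ))⌉ : ℝ)
        + 6 * (⌈Real.logb 2 (⌈Real.sqrt (Real.logb 2 (n : ℝ))⌉ : ℝ)⌉ : ℝ) + 2 := by
  have hn' : (1 : ℝ) ≤ n := by exact_mod_cast hn
  set l : ℝ := Real.logb 2 n with hl
  have hl0 : 0 ≤ l := Real.logb_nonneg (by norm_num) hn'
  have hpow : (2 : ℝ) ^ l = n := Real.rpow_logb (by norm_num) (by norm_num) (by linarith)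
  set s : ℕ := ⌈Real.sqrt l⌉₊ with hs
  have hceil : ⌈Real.sqrt l⌉ = (s : ℤ) := (Int.natCast_ceil_eq_ceil (Real.sqrt_nonneg l)).symm
  have hlog : (Nat.log 2 n : ℝ) ≤ l := Real.natLog_le_logb n 2
  have hclog : ⌈Real.logb 2 (⌈Real.sqrt l⌉ : ℝ)⌉ = (Nat.clog 2 s : ℤ) := by
    rw [hceil, Int.cast_natCast]
    have h := Real.ceil_logb_natCast (b := 2) (r := (s : ℝ)) (Nat.cast_nonneg s)
    rwa [Int.clog_natCast, Nat.cast_ofNat] at h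
  have hupper : n ≤ 2 ^ (s * s) := by
    have h1 : l ≤ (s * s : ℕ) := by
      have h2 : Real.sqrt l ≤ s := Nat.le_ceil _
      push_cast
      rw [← Real.mul_self_sqrt hl0]
      exact mul_self_le_mul_self (Real.sqrt_nonneg l) h2
    have h3 : (n : ℝ) ≤ (2 : ℝ) ^ ((s * s : ℕ) : ℝ) := by
      rw [← hpow]
      exact Real.rpow_le_rpow_of_exponent_le (by norm_num) h1
    rw [Real.rpow_natCast] at h3
    exact_mod_cast h3
  have hlower : 2 ^ ((s - 1) * (s - 1)) ≤ n := by
    have h1 : (((s - 1) * (s - 1) : ℕ) : ℝ) ≤ l := by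
      have h2 : ((s - 1 : ℕ) : ℝ) ≤ Real.sqrt l := by
        rcases Nat.eq_zero_or_pos s with h0 | h0
        · rw [h0]
          simp
        · exact (Nat.lt_ceil.1 (show s - 1 < ⌈Real.sqrt l⌉₊ by omega)).le
      push_cast
      rw [← Real.mul_self_sqrt hl0]
      exact mul_self_le_mul_self (Nat.cast_nonneg _) h2
    have h3 : (2 : ℝ) ^ (((s - 1) * (s - 1) : ℕ) : ℝ) ≤ n := by
      rw [← hpow]
      exact Real.rpow_le_rpow_of_exponent_le (by norm_num) h1
    rw [Real.rpow_natCast] at h3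
    exact_mod_cast h3
  obtain ⟨S, D, hS, hD, h⟩ := exists_carryCircuit hn hupper hlower
  obtain ⟨C, hadd, hfan, hsize, hdepth⟩ := h.exists_isAdder hn
  have hsize' : (C.size : ℝ) ≤ 9.5 * n := by
    have h1 : 2 * C.size ≤ 19 * n := by omega
    have h2 : (2 * C.size : ℝ) ≤ 19 * n := by exact_mod_cast h1
    linarith
  refine ⟨C, hadd, hfan, by linarith, fun _ => hsize', ?_⟩
  rw [hclog, hceil]
  have h1 : C.depth ≤ Nat.log 2 n + 8 * s + 6 * Nat.clog 2 s + 2 := hdepth.trans hD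
  have h2 : (C.depth : ℝ) ≤ Nat.log 2 n + 8 * s + 6 * Nat.clog 2 s + 2 := by exact_mod_cast h1
  push_cast
  linarith
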